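/- \textbf{Setting.} For $L\ge 1$, the toric code of size $L$ is defined on the $L\times L$ square lattice with periodic boundaries: qubits are the edges, $Z$-checks the vertices, $X$-checks the plaquettes. Its distance is the smallest weight of a logical operator (an $X$- or $Z$-type operator commuting with all checks and not a product of checks). We decode $X$-errors ($Z$-errors are the same on the dual lattice). An error is a vector $\mathbf e\in\mathbb F_2^{Q}$ indexed by the set $Q$ of qubits, $|\mathbf e|$ is its Hamming weight, $\mathbf s=\mathbf H\mathbf e$ is its syndrome, where $\mathbf H$ is the vertex--edge incidence matrix over $\mathbb F_2$, and $\mathcal N(\cdot)$ denotes incident edges of a vertex or incident vertices of an edge. The error $\mathbf e$ is \emph{degenerate} if there is $\mathbf e'\ne\mathbf e$ with $|\mathbf e'|\le|\mathbf e|$ and $\mathbf H\mathbf e'=\mathbf H\mathbf e$, and \emph{non-degenerate} otherwise. The \emph{min-sum (MS) decoder} with flooded scheduling and a priori values $1$ starts from $\alpha^{(0)}_{q\to c}=1$ and $\textsc{app}(q,0)=1$ and computes, for $i\ge 1$, $$\beta^{(i)}_{c\to q}=(-1)^{\mathbf s(c)}\prod_{q'\in\mathcal N(c)\setminus\{q\}}\operatorname{sgn}\alpha^{(i-1)}_{q'\to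 c}\cdot\min_{q'\in\mathcal N(c)\setminus\{q\}}\bigl|\alpha^{(i-1)}_{q'\to c}\bigr|,$$ $$\alpha^{(i)}_{q\to c}=1+\sum_{c'\in\mathcal N(q)\setminus\{c\}}\beta^{(i)}_{c'\to q},\qquad \textsc{app}(q,i)=1+\sum_{c\in\mathcal N(q)}\beta^{(i)}_{c\to q}.$$ The estimate $\hat{\mathbf e}_i$ has $\hat{\mathbf e}_i(q)=1$ if $\textsc{app}(q,i)<0$ and $\hat{\mathbf e}_i(q)=0$ if $\textsc{app}(q,i)>0$; if $\textsc{app}(q,i)=0$, it is chosen by an arbitrary tie-breaking rule, which may depend on $\mathbf s$, $i$ and $q$. The decoder stops at the first iteration $i\ge 0$ with $\mathbf H\hat{\mathbf e}_i=\mathbf s$, if there is one, and then outputs $\hat{\mathbf e}_i$. The \emph{non-degenerate decoding radius} is the largest integer $\omega$ such that all non-degenerate errors of weight $\le\omega$ are correctly decoded. \textbf{Theorem.} For every toric code of distance at least $9$, and for every tie-breaking rule, the non-degenerate decoding radius of the MS decoder is exactly $3$. This holds both when ``$\mathbf e$ is correctly decoded'' means that the decoder stops and outputs $\mathbf e$ itself,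 and when it means only that the decoder stops, i.e. that it finds some error satisfying the syndrome. Moreover, every error $\epsilon^4$ that consists of four consecutive edges on a horizontal or vertical line of the lattice has weight $4$ and is non-degenerate, and on its syndrome the decoder never stops: no estimate $\hat{\mathbf e}_i$, $i\ge0$, satisfies the syndrome. -/

import Mathlib

open scoped Matrix

noncomputable section

/-! ### Errors, syndromes, degeneracy

An error on the set of qubits `Q` is a vector `e : Q → ZMod 2`, its syndrome with respect to the
parity-check matrix `H` is `H *ᵥ e`, and its weight is `hammingNorm e`. -/

section General

variable {C Q : Type*} [Fintype C] [DecidableEq C] [Fintype Q] [DecidableEq Q]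

/-- `e` is degenerate if another error of at most the same weight has the same syndrome. -/
def IsDegenerate (H : Matrix C Q (ZMod 2)) (e : Q → ZMod 2) : Prop :=
  ∃ e' : Q → ZMod 2, e' ≠ e ∧ hammingNorm e' ≤ hammingNorm e ∧ H *ᵥ e' = H *ᵥ e

/-- `ω` is the non-degenerate decoding radius, `Decoded e` meaning that the decoder succeeds on the
syndrome of the error `e`: it is the largest integer such that all non-degenerate errors of weight
at most `ω` are decoded. -/
def IsNonDegenerateDecodingRadius (H : Matrix C Q (ZMod 2)) (Decoded : (Q → ZMod 2) → Prop)
    (ω : ℕ) : Prop :=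
  IsGreatest {w : ℕ | ∀ e : Q → ZMod 2, ¬ IsDegenerate H e → hammingNorm e ≤ w → Decoded e} ω

/-- Minimum distance of the CSS code with check matrices `HX` and `HZ`: the smallest weight of a
logical operator, i.e. of an `X`-type (resp. `Z`-type) operator that commutes with all the checks
and is not a product of checks. -/
def cssDistance {CX CZ : Type*} (HX : Matrix CX Q (ZMod 2)) (HZ : Matrix CZ Q (ZMod 2)) : ℕ :=
  sInf {w : ℕ | ∃ e : Q → ZMod 2, hammingNorm e = w ∧
    ((HZ *ᵥ e = 0 ∧ e ∉ Submodule.span (ZMod 2) (Set.range HX.row)) ∨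
      (HX *ᵥ e = 0 ∧ e ∉ Submodule.span (ZMod 2) (Set.range HZ.row)))}

/-! ### The min-sum decoder with flooded scheduling

All qubits have the a priori value `1`. -/

/-- The qubits in the check `c` (neighbours of `c` in the Tanner graph). -/
def checkNeighbors (H : Matrix C Q (ZMod 2)) (c : C) : Finset Q :=
  Finset.univ.filter fun q => H c q = 1

/-- The checks that contain the qubit `q` (neighbours of `q` in the Tanner graph). -/
def qubitNeighbors (H : Matrix C Q (ZMod 2)) (q : Q) : Finset C :=
  Finset.univ.filter fun c => H c q = 1

/-- Message from the check `c` to its neighbour `q`, computed from the qubit-to-check messages `α`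
that enter `c` from its other neighbours: the product of their signs and of `(-1) ^ s c`, times the
minimum of their absolute values. (A check has at least two neighbours, so that the minimum is over
a non-empty set.) -/
def msCheckMessage (H : Matrix C Q (ZMod 2)) (s : C → ZMod 2) (α : Q → C → ℤ) (c : C) (q : Q) : ℤ :=
  (if s c = 0 then 1 else -1) * (∏ q' ∈ (checkNeighbors H c).erase q, (α q' c).sign) *
    ((⨅ q' : {q' // q' ∈ (checkNeighbors H c).erase q}, (α q' c).natAbs : ℕ) : ℤ)

/-- Message from the qubit `q` to its neighbour `c` after `i` iterations: the a priori value plus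
the messages that enter `q` from its other neighbours. -/
def msQubitMessage (H : Matrix C Q (ZMod 2)) (s : C → ZMod 2) : ℕ → Q → C → ℤ
  | 0 => fun _ _ => 1
  | i + 1 => fun q c => 1 + ∑ c' ∈ (qubitNeighbors H q).erase c,
      msCheckMessage H s (msQubitMessage H s i) c' q

/-- The a posteriori value of the qubit `q` at iteration `i`. -/
def msApp (H : Matrix C Q (ZMod 2)) (s : C → ZMod 2) : ℕ → Q → ℤ
  | 0 => fun _ => 1
  | i + 1 => fun q => 1 + ∑ c ∈ qubitNeighbors H q,
      msCheckMessage H s (msQubitMessage H s i) c q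

/-- The error estimated at iteration `i` on the syndrome `s`. A qubit with a posteriori value `0` is
decided by the tie-breaking rule `tie`. -/
def msEstimate (H : Matrix C Q (ZMod 2)) (tie : (C → ZMod 2) → ℕ → Q → ZMod 2)
    (s : C → ZMod 2) (i : ℕ) : Q → ZMod 2 := fun q =>
  if msApp H s i q < 0 then 1 else if 0 < msApp H s i q then 0 else tie s i q

/-- The decoder stops at iteration `k` on the syndrome `s`: the estimated error satisfies the
syndrome at iteration `k` and not before. -/
def MSStopsAt (H : Matrix C Q (ZMod 2)) (tie : (C → ZMod 2) → ℕ → Q → ZMod 2)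
    (s : C → ZMod 2) (k : ℕ) : Prop :=
  IsLeast {i : ℕ | H *ᵥ msEstimate H tie s i = s} k

/-- On the syndrome of `e` the decoder stops, with a valid correction as output. -/
def MSFindsCorrection (H : Matrix C Q (ZMod 2)) (tie : (C → ZMod 2) → ℕ → Q → ZMod 2)
    (e : Q → ZMod 2) : Prop :=
  ∃ k, MSStopsAt H tie (H *ᵥ e) k

/-- On the syndrome of `e` the decoder stops, with `e` itself as output. -/
def MSRecovers (H : Matrix C Q (ZMod 2)) (tie : (C → ZMod 2) → ℕ → Q → ZMod 2)
    (e : Q → ZMod 2) : Prop :=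
  ∃ k, MSStopsAt H tie (H *ᵥ e) k ∧ msEstimate H tie (H *ᵥ e) k = e

end General

/-! ### The toric code on the `L × L` square lattice with periodic boundaries -/

/-- Vertices of the lattice, which carry the `Z` checks. The plaquettes, which carry the `X` checks,
are indexed by their lower left corner. -/
abbrev ToricVertex (L : ℕ) : Type := ZMod L × ZMod L

/-- Edges of the lattice, which carry the qubits: `(b, v)` joins `v` and `v + toricStep L b`. -/
abbrev ToricQubit (L : ℕ) : Type := Bool × ToricVertex L

/-- The unit step in the horizontal (`false`) or vertical (`true`) direction. -/
def toricStep (L : ℕ) : Bool → ToricVertex L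
  | false => (1, 0)
  | true => (0, 1)

/-- Vertex checks: incidence matrix of vertices and edges. -/
def toricHZ (L : ℕ) : Matrix (ToricVertex L) (ToricQubit L) (ZMod 2) :=
  Matrix.of fun c q =>
    (if c = q.2 then 1 else 0) + (if c = q.2 + toricStep L q.1 then 1 else 0)

/-- Plaquette checks: for each direction `b`, the boundary of the plaquette `p` contains the edge
`(b, p)` and the parallel edge one step further in the other direction. -/
def toricHX (L : ℕ) : Matrix (ToricVertex L) (ToricQubit L) (ZMod 2) :=
  Matrix.of fun p q =>
    (if q.2 = p then 1 else 0) + (if q.2 = p + toricStep L (!q.1) then 1 else 0)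

/-- The distance of the toric code. -/
def toricDistance (L : ℕ) [NeZero L] : ℕ := cssDistance (toricHX L) (toricHZ L)

/-- Four consecutive qubits in error on a line of direction `b`, starting at the vertex `v`. -/
def fourInARow (L : ℕ) (b : Bool) (v : ToricVertex L) : ToricQubit L → ZMod 2 :=
  fun q => if ∃ k : Fin 4, q = (b, v + (k : ℕ) • toricStep L b) then 1 else 0

end

/-! Every qubit of the toric code lies in two checks, so the message that an edge sends to one end
is 1 plus the check message from its other end. Min-sum thus becomes a synchronous recursion with
one integer per vertex and direction (`msQubitMessage_tedge`, `msApp_tedge`). Both halves of the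
radius come from finite computations on this recursion that transfer to every `L ≥ 9`; the distance
hypothesis gives this bound because a line around the torus is a logical operator
(`toricDistance_le`).

Weight at most 3. At iterations 1 and 2 no a posteriori value is zero, and the value of an edge
depends only on the syndrome at its ends and their neighbours, hence on the error at 23 nearby
edges. All 2048 choices of at most three of these are checked (`forallSublists_nearEdges`). Either
the central edge is estimated correctly at iteration 2, and also at iteration 1 unless that estimate
violates the syndrome; or the error contains half of a cycle of length 4 or 6 and is degenerate; or
all three errors are nearby and a simulation of the decoder recovers them. If the first case holds
around every edge, then the estimate at iteration 2 is the error, and no wrong estimate stops the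
decoder earlier.

Four edges in a row. A competitor of weight at most 4 differs from the row by a cycle of weight at
most 8, less than the distance, so by a sum of plaquettes, which meets every cut of the torus
evenly. The competitor then has exactly one edge on each of the four cuts met by the row, and a
cycle made of such parallel edges must vanish (`not_isDegenerate_fourInARow`). That the decoder
never stops is shown by simulation.

Simulation. One-sided bounds for the messages on a square patch are propagated as bit masks, with
one common positive lower bound for the messages outside. An iteration is refuted by a vertex whose
four edges have strict signs of the wrong parity, so ties play no role. For all iterations at once,
the bounds after 9 iterations are shown to follow from those 6 iterations later; they therefore hold
again every 6 iterations, and so do the refutations. The torus itself is simulated for `L = 9` and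
`L = 10`, and an open 11 × 11 patch serves all `L ≥ 11`. -/

open scoped Matrix

/-! ### Min-sum on a graph with four directions -/

/-- The commutative, associative operation `sign x * sign y * min |x| |y|` on the integers. -/
def minSum (x y : ℤ) : ℤ := max (min x y) (min (-x) (-y))

/-- The right-hand side is the form found in the decoder; the max-min form of the definition is the
one suited to threshold bounds. -/
theorem minSum_eq (x y : ℤ) :
    minSum x y = x.sign * y.sign * ((min x.natAbs y.natAbs : ℕ) : ℤ) := by
  unfold minSum
  rcases lt_trichotomy x 0 with hx | rfl | hx <;> rcases lt_trichotomy y 0 with hy | rfl | hy <;>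
    simp only [Int.sign_eq_one_of_pos, Int.sign_eq_neg_one_of_neg, Int.sign_zero, *] <;> omega

theorem natAbs_minSum (x y : ℤ) : (minSum x y).natAbs = min x.natAbs y.natAbs := by
  unfold minSum; omega

theorem sign_minSum (x y : ℤ) : (minSum x y).sign = x.sign * y.sign := by
  unfold minSum
  rcases lt_trichotomy x 0 with hx | rfl | hx <;> rcases lt_trichotomy y 0 with hy | rfl | hy <;>
    simp [Int.sign_eq_one_of_pos, Int.sign_eq_neg_one_of_neg, *] <;> omega

theorem minSum_neg_left (x y : ℤ) : minSum (-x) y = -minSum x y := by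
  unfold minSum; omega

/-- A direction in a square lattice: an axis and an orientation. -/
abbrev Dir : Type := Bool × Bool

/-- The opposite direction. -/
abbrev Dir.opp (d : Dir) : Dir := (d.1, !d.2)

/-- The min-sum messages on a graph in which each vertex has one neighbour in each direction:
`caMsg nb s i v d` is the message at iteration `i` on the edge from `v` to `nb v d`, towards
`nb v d`, where `s` is the indicator of the unsatisfied checks. -/
def caMsg {V : Type*} (nb : V → Dir → V) (s : V → Bool) : ℕ → V → Dir → ℤ
  | 0, _, _ => 1
  | i + 1, v, d =>
    1 + (if s v = true then -1 else 1) *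
      minSum (caMsg nb s i (nb v (d.1, !d.2)) d)
        (minSum (caMsg nb s i (nb v (!d.1, true)) (!d.1, false))
          (caMsg nb s i (nb v (!d.1, false)) (!d.1, true)))

/-- The a posteriori value of the edge between `v` and `nb v d`. -/
def caApp {V : Type*} (nb : V → Dir → V) (s : V → Bool) (i : ℕ) (v : V) (d : Dir) : ℤ :=
  caMsg nb s i v d + caMsg nb s i (nb v d) d.opp - 1

/-- The neighbour of a vertex of the torus in a given direction; the axes are exchanged
if `b = true`. -/
def tnb (L : ℕ) (b : Bool) (v : ToricVertex L) (d : Dir) : ToricVertex L :=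
  if d.2 then v + toricStep L (xor b d.1) else v - toricStep L (xor b d.1)

/-- The edge at a vertex of the torus in a given direction; the axes are exchanged
if `b = true`. -/
def tedge (L : ℕ) (b : Bool) (v : ToricVertex L) (d : Dir) : ToricQubit L :=
  (xor b d.1, if d.2 then v else v - toricStep L (xor b d.1))

/-! ### The decoder of the toric code as a recursion on vertices and directions -/

section Torus

variable {L : ℕ}

theorem tnb_opp (b : Bool) (v : ToricVertex L) (d : Dir) : tnb L b (tnb L b v d) d.opp = v := by
  rcases d with ⟨a, _ | _⟩ <;> simp [tnb]

theorem tedge_opp (b : Bool) (v : ToricVertex L) (d : Dir) :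
    tedge L b (tnb L b v d) d.opp = tedge L b v d := by
  rcases d with ⟨a, _ | _⟩ <;> simp [tnb, tedge]

theorem natCast_ne_zero_of_lt {k : ℕ} (h0 : 0 < k) (hk : k < L) : (k : ZMod L) ≠ 0 := by
  intro h
  rw [ZMod.natCast_eq_zero_iff] at h
  exact absurd (Nat.le_of_dvd h0 h) (by omega)

theorem toricStep_ne_zero (hL : 3 ≤ L) (b : Bool) : toricStep L b ≠ 0 := by
  have h1 := natCast_ne_zero_of_lt (L := L) one_pos (by omega)
  cases b <;> simpa [toricStep, Prod.ext_iff] using h1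

theorem toricHZ_apply_eq_one (hL : 3 ≤ L) (c : ToricVertex L) (q : ToricQubit L) :
    toricHZ L c q = 1 ↔ c = q.2 ∨ c = q.2 + toricStep L q.1 := by
  have h := toricStep_ne_zero hL q.1
  simp only [toricHZ, Matrix.of_apply]
  by_cases h1 : c = q.2 <;> by_cases h2 : c = q.2 + toricStep L q.1
  · rw [h1] at h2; exact absurd (by simpa using h2) h
  · simp [h1, h]
  · simp [h2, h]
  · simp [h1, h2]

/-- The step is nonzero, so the four edges at a vertex are distinct and the product and minimum in a
check message run over exactly three edges. -/
theorem tedge_injective (hL : 3 ≤ L) (b : Bool) (v : ToricVertex L) :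
    Function.Injective (tedge L b v) := by
  rintro ⟨a, f⟩ ⟨a', f'⟩ h
  simp only [tedge, Prod.mk.injEq] at h
  obtain ⟨h1, h2⟩ := h
  have : a = a' := by simpa using h1
  subst this
  have h0 := toricStep_ne_zero hL (xor b a)
  cases f <;> cases f' <;> simp_all [sub_eq_self, eq_comm (a := v)]

theorem checkNeighbors_toricHZ [NeZero L] (hL : 3 ≤ L) (b : Bool) (c : ToricVertex L) :
    checkNeighbors (toricHZ L) c = Finset.univ.image (tedge L b c) := by
  ext ⟨a, w⟩
  simp only [checkNeighbors, Finset.mem_filter, Finset.mem_univ, true_and,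
    toricHZ_apply_eq_one hL, Finset.mem_image]
  constructor
  · rintro (rfl | rfl)
    · exact ⟨(xor b a, true), by simp [tedge]⟩
    · exact ⟨(xor b a, false), by simp [tedge]⟩
  · rintro ⟨⟨a', _ | _⟩, h⟩ <;> simp only [tedge, Prod.mk.injEq] at h <;> obtain ⟨rfl, rfl⟩ := h
    · right; simp
    · left; simp

theorem tnb_ne (hL : 3 ≤ L) (b : Bool) (v : ToricVertex L) (d : Dir) : tnb L b v d ≠ v := by
  have h0 := toricStep_ne_zero hL (xor b d.1)
  rcases d with ⟨a, _ | _⟩ <;> simpa [tnb] using h0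

theorem qubitNeighbors_toricHZ [NeZero L] (hL : 3 ≤ L) (b : Bool) (v : ToricVertex L) (d : Dir) :
    qubitNeighbors (toricHZ L) (tedge L b v d) = {v, tnb L b v d} := by
  ext c
  simp only [qubitNeighbors, Finset.mem_filter, Finset.mem_univ, true_and,
    toricHZ_apply_eq_one hL, Finset.mem_insert, Finset.mem_singleton]
  rcases d with ⟨a, _ | _⟩ <;> simp [tedge, tnb, or_comm]

theorem iInf_three {α : Type*} [DecidableEq α] (f : α → ℕ) (x y z : α) :
    (⨅ q : {q // q ∈ ({x, y, z} : Finset α)}, f q) = min (f x) (min (f y) (f z)) := by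
  apply le_antisymm
  · refine le_min ?_ (le_min ?_ ?_)
    · exact ciInf_le (OrderBot.bddBelow _) (⟨x, by simp⟩ : {q // q ∈ ({x, y, z} : Finset α)})
    · exact ciInf_le (OrderBot.bddBelow _) (⟨y, by simp⟩ : {q // q ∈ ({x, y, z} : Finset α)})
    · exact ciInf_le (OrderBot.bddBelow _) (⟨z, by simp⟩ : {q // q ∈ ({x, y, z} : Finset α)})
  · have : Nonempty {q // q ∈ ({x, y, z} : Finset α)} := ⟨⟨x, by simp⟩⟩
    refine le_ciInf fun ⟨q, hq⟩ => ?_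
    simp only [Finset.mem_insert, Finset.mem_singleton] at hq
    rcases hq with rfl | rfl | rfl <;> simp

theorem msCheckMessage_toricHZ [NeZero L] (hL : 3 ≤ L) (b : Bool) (s : ToricVertex L → ZMod 2)
    (α : ToricQubit L → ToricVertex L → ℤ) (v : ToricVertex L) (d : Dir) :
    msCheckMessage (toricHZ L) s α v (tedge L b v d) =
      (if s v = 0 then 1 else -1) * minSum (α (tedge L b v (d.1, !d.2)) v)
        (minSum (α (tedge L b v (!d.1, true)) v) (α (tedge L b v (!d.1, false)) v)) := by
  have hinj := tedge_injective hL b v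
  have hset : (checkNeighbors (toricHZ L) v).erase (tedge L b v d) =
      {tedge L b v (d.1, !d.2), tedge L b v (!d.1, true), tedge L b v (!d.1, false)} := by
    rw [checkNeighbors_toricHZ hL b, ← Finset.image_erase hinj]
    have : (Finset.univ.erase d : Finset Dir) = {(d.1, !d.2), (!d.1, true), (!d.1, false)} := by
      revert d; decide
    rw [this]; simp [Finset.image_insert]
  unfold msCheckMessage
  rw [hset, iInf_three (fun q => (α q v).natAbs), Finset.prod_insert, Finset.prod_insert,
    Finset.prod_singleton, minSum_eq, natAbs_minSum, sign_minSum]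
  · simp only [mul_assoc]
  · simp [hinj.eq_iff]
  · rcases d with ⟨a, f⟩
    simp [hinj.eq_iff]

/-- The unsatisfied checks, as a Boolean function. -/
def defect {V : Type*} (s : V → ZMod 2) (v : V) : Bool := decide (s v ≠ 0)

/-- After removing the receiving end, a single check contributes to the sum. Its three incoming
messages are the previous ones on the other edges at `v`, read from their far ends, which is the
recursion of `caMsg`. -/
theorem msQubitMessage_tedge [NeZero L] (hL : 3 ≤ L) (b : Bool) (s : ToricVertex L → ZMod 2)
    (i : ℕ) (v : ToricVertex L) (d : Dir) :
    msQubitMessage (toricHZ L) s i (tedge L b v d) (tnb L b v d) =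
      caMsg (tnb L b) (defect s) i v d := by
  induction i generalizing v d with
  | zero => rfl
  | succ i ih =>
    have key : ∀ k : Dir, msQubitMessage (toricHZ L) s i (tedge L b v k) v =
        caMsg (tnb L b) (defect s) i (tnb L b v k) k.opp := by
      intro k
      rw [← ih, tnb_opp, tedge_opp]
    have hs : ({v, tnb L b v d} : Finset (ToricVertex L)).erase (tnb L b v d) = {v} := by
      rw [Finset.pair_comm, Finset.erase_insert]
      simpa using tnb_ne hL b v d
    simp only [msQubitMessage]
    rw [qubitNeighbors_toricHZ hL, hs, Finset.sum_singleton,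
      msCheckMessage_toricHZ hL, key, key, key, caMsg]
    by_cases h : s v = 0 <;> simp [defect, h, Dir.opp]

/-- With `β`, `β'` the check messages at the two ends, `1 + β + β' = (1 + β) + (1 + β') - 1`. -/
theorem msApp_tedge [NeZero L] (hL : 3 ≤ L) (b : Bool) (s : ToricVertex L → ZMod 2)
    (i : ℕ) (v : ToricVertex L) (d : Dir) :
    msApp (toricHZ L) s i (tedge L b v d) = caApp (tnb L b) (defect s) i v d := by
  cases i with
  | zero => simp [msApp, caApp, caMsg]
  | succ i =>
    have key : ∀ (v : ToricVertex L) (d : Dir),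
        1 + msCheckMessage (toricHZ L) s (msQubitMessage (toricHZ L) s i) v (tedge L b v d) =
        caMsg (tnb L b) (defect s) (i + 1) v d := by
      intro v d
      have hs : ({v, tnb L b v d} : Finset (ToricVertex L)).erase (tnb L b v d) = {v} := by
        rw [Finset.pair_comm, Finset.erase_insert]
        simpa using tnb_ne hL b v d
      rw [← msQubitMessage_tedge hL]
      simp only [msQubitMessage]
      rw [qubitNeighbors_toricHZ hL, hs,
        Finset.sum_singleton]
    simp only [msApp]
    rw [qubitNeighbors_toricHZ hL, Finset.sum_pair (tnb_ne hL b v d).symm, caApp, ← key,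
      ← key, tedge_opp]
    ring

theorem toricHZ_mulVec [NeZero L] (hL : 3 ≤ L) (b : Bool) (e : ToricQubit L → ZMod 2)
    (c : ToricVertex L) : (toricHZ L *ᵥ e) c = ∑ d : Dir, e (tedge L b c d) := by
  have h1 : ∀ q, toricHZ L c q * e q = if q ∈ checkNeighbors (toricHZ L) c then e q else 0 := by
    intro q
    simp only [checkNeighbors, Finset.mem_filter, Finset.mem_univ, true_and]
    have : ∀ a : ZMod 2, a = 1 ∨ a = 0 := by decide
    rcases this (toricHZ L c q) with h | h <;> simp [h]
  simp only [Matrix.mulVec, dotProduct]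
  rw [Finset.sum_congr rfl fun q _ => h1 q, Finset.sum_ite_mem, Finset.univ_inter,
    checkNeighbors_toricHZ hL b, Finset.sum_image fun x _ y _ h => tedge_injective hL b c h]

end Torus

/-! ### Coordinates on the torus, chains of edges, degenerate errors -/

/-- The point of the torus with coordinates `x`, `y` in the frame with origin `o`, with the axes
exchanged if `b = true`. -/
def npt (L : ℕ) (b : Bool) (o : ToricVertex L) (x y : ℕ) : ToricVertex L :=
  o + x • toricStep L b + y • toricStep L (!b)

/-- The edge of the torus in direction `q.1` at the point with coordinates `q.2`. -/
def nqubit (L : ℕ) (b : Bool) (o : ToricVertex L) (q : Bool × ℕ × ℕ) : ToricQubit L :=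
  (xor b q.1, npt L b o q.2.1 q.2.2)

/-- The sum of a list of edges, with coefficients in `ZMod 2`. -/
def chain (L : ℕ) (b : Bool) (o : ToricVertex L) (P : List (Bool × ℕ × ℕ)) :
    ToricQubit L → ZMod 2 :=
  (P.map fun q => Pi.single (nqubit L b o q) 1).sum

section

variable {L : ℕ}

theorem npt_npt (b : Bool) (o : ToricVertex L) (x y x' y' : ℕ) :
    npt L b (npt L b o x y) x' y' = npt L b o (x + x') (y + y') := by
  simp only [npt, add_smul]; abel

theorem npt_inj (b : Bool) (o : ToricVertex L) {x y x' y' : ℕ} (hx : x < L) (hy : y < L)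
    (hx' : x' < L) (hy' : y' < L) (h : npt L b o x y = npt L b o x' y') : x = x' ∧ y = y' := by
  have key : ∀ a a' : ℕ, a < L → a' < L → (a : ZMod L) = a' → a = a' := by
    intro a a' ha ha' h
    rwa [ZMod.natCast_eq_natCast_iff', Nat.mod_eq_of_lt ha, Nat.mod_eq_of_lt ha'] at h
  have h' : (x : ZMod L) = x' ∧ (y : ZMod L) = y' := by
    cases b <;> simpa [npt, toricStep, Prod.ext_iff, and_comm] using h
  exact ⟨key _ _ hx hx' h'.1, key _ _ hy hy' h'.2⟩

theorem nqubit_inj (b : Bool) (o : ToricVertex L) {q q' : Bool × ℕ × ℕ} (h1 : q.2.1 < L)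
    (h2 : q.2.2 < L) (h1' : q'.2.1 < L) (h2' : q'.2.2 < L)
    (h : nqubit L b o q = nqubit L b o q') : q = q' := by
  simp only [nqubit, Prod.mk.injEq] at h
  have h3 := npt_inj b o h1 h2 h1' h2' h.2
  have h4 : q.1 = q'.1 := by simpa using h.1
  exact Prod.ext h4 (Prod.ext h3.1 h3.2)

theorem tnb_npt_right (b : Bool) (o : ToricVertex L) (x y : ℕ) :
    tnb L b (npt L b o x y) (false, true) = npt L b o (x + 1) y := by
  simp only [tnb, npt, Bool.xor_false, if_true, add_smul, one_smul]; abel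

theorem tnb_npt_up (b : Bool) (o : ToricVertex L) (x y : ℕ) :
    tnb L b (npt L b o x y) (true, true) = npt L b o x (y + 1) := by
  simp only [tnb, npt, Bool.xor_true, if_true, add_smul, one_smul]; abel

theorem tnb_npt_left (b : Bool) (o : ToricVertex L) (x y : ℕ) :
    tnb L b (npt L b o (x + 1) y) (false, false) = npt L b o x y := by
  rw [← tnb_npt_right]; exact tnb_opp b _ (false, true)

theorem tnb_npt_down (b : Bool) (o : ToricVertex L) (x y : ℕ) :
    tnb L b (npt L b o x (y + 1)) (true, false) = npt L b o x y := by
  rw [← tnb_npt_up]; exact tnb_opp b _ (true, true)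

theorem tedge_npt (b : Bool) (o : ToricVertex L) (a : Bool) (x y : ℕ) :
    tedge L b (npt L b o x y) (a, true) = nqubit L b o (a, x, y) := by
  simp [tedge, nqubit]

theorem tedge_npt_left (b : Bool) (o : ToricVertex L) (x y : ℕ) :
    tedge L b (npt L b o (x + 1) y) (false, false) = nqubit L b o (false, x, y) := by
  rw [← tedge_opp, tnb_npt_left, ← tedge_npt]; rfl

theorem tedge_npt_down (b : Bool) (o : ToricVertex L) (x y : ℕ) :
    tedge L b (npt L b o x (y + 1)) (true, false) = nqubit L b o (true, x, y) := by
  rw [← tedge_opp, tnb_npt_down, ← tedge_npt]; rfl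

theorem exists_npt_eq (b : Bool) (v : ToricVertex L) (x y : ℕ) :
    ∃ o, npt L b o x y = v :=
  ⟨v - x • toricStep L b - y • toricStep L (!b), by simp only [npt]; abel⟩

theorem chain_nil (b : Bool) (o : ToricVertex L) : chain L b o [] = 0 := rfl

theorem chain_cons (b : Bool) (o : ToricVertex L) (q : Bool × ℕ × ℕ) (P : List (Bool × ℕ × ℕ)) :
    chain L b o (q :: P) = Pi.single (nqubit L b o q) 1 + chain L b o P := by
  simp [chain]

theorem chain_apply (b : Bool) (o : ToricVertex L) {P : List (Bool × ℕ × ℕ)}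
    (hP : (P.map (nqubit L b o)).Nodup) (q : ToricQubit L) :
    chain L b o P q = if q ∈ P.map (nqubit L b o) then 1 else 0 := by
  induction P with
  | nil => simp [chain_nil]
  | cons p P ih =>
    rw [List.map_cons, List.nodup_cons] at hP
    rw [chain_cons, Pi.add_apply, ih hP.2, Pi.single_apply]
    by_cases h : q = nqubit L b o p
    · subst h; simp [hP.1]
    · simp only [h, if_false, zero_add, List.map_cons, List.mem_cons, false_or]

variable [NeZero L]

theorem toricHZ_mulVec_single (q : ToricQubit L) :
    toricHZ L *ᵥ Pi.single q 1 = Pi.single q.2 1 + Pi.single (q.2 + toricStep L q.1) 1 := by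
  ext c
  simp [toricHZ, Pi.single_apply]

/-- The end of an edge other than the one that gives its coordinates. -/
def edgeEnd (q : Bool × ℕ × ℕ) : ℕ × ℕ := bif q.1 then (q.2.1, q.2.2 + 1) else (q.2.1 + 1, q.2.2)

theorem toricHZ_mulVec_single_nqubit (b : Bool) (o : ToricVertex L) (q : Bool × ℕ × ℕ) :
    toricHZ L *ᵥ Pi.single (nqubit L b o q) 1 =
      Pi.single (npt L b o q.2.1 q.2.2) 1 +
        Pi.single (npt L b o (edgeEnd q).1 (edgeEnd q).2) 1 := by
  rw [toricHZ_mulVec_single]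
  congr 2
  rcases q with ⟨_ | _, x, y⟩ <;> simp only [nqubit, npt, edgeEnd, Bool.xor_false, Bool.xor_true,
    cond_true, cond_false, add_smul, one_smul] <;> abel

theorem toricHZ_mulVec_chain_cons (b : Bool) (o : ToricVertex L) (q : Bool × ℕ × ℕ)
    (P : List (Bool × ℕ × ℕ)) :
    toricHZ L *ᵥ chain L b o (q :: P) = Pi.single (npt L b o q.2.1 q.2.2) 1 +
        Pi.single (npt L b o (edgeEnd q).1 (edgeEnd q).2) 1 + toricHZ L *ᵥ chain L b o P := by
  rw [chain_cons, Matrix.mulVec_add, toricHZ_mulVec_single_nqubit]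

end

theorem hammingNorm_eq_card_support {Q : Type*} [Fintype Q] [DecidableEq Q] (e : Q → ZMod 2) :
    hammingNorm e = (Finset.univ.filter fun q => e q ≠ 0).card := rfl

/-- An error is degenerate if it contains at least half of the edges of a cycle. -/
theorem isDegenerate_of_cycle {C Q : Type*} [Fintype C] [DecidableEq C] [Fintype Q] [DecidableEq Q]
    {H : Matrix C Q (ZMod 2)} {e : Q → ZMod 2} (T : Finset Q) (hT : T.Nonempty)
    (hH : H *ᵥ (fun q => if q ∈ T then 1 else 0) = 0)
    (h : T.card ≤ 2 * (T.filter fun q => e q ≠ 0).card) : IsDegenerate H e := by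
  set χ : Q → ZMod 2 := fun q => if q ∈ T then 1 else 0 with hχ
  refine ⟨e + χ, ?_, ?_, by rw [Matrix.mulVec_add, hH, add_zero]⟩
  · obtain ⟨q, hq⟩ := hT
    intro heq
    have : χ q = 0 := by simpa using congrFun heq q
    simp [hχ, hq] at this
  · set S := Finset.univ.filter fun q => e q ≠ 0 with hS
    -- Adding the cycle `T` turns the support `S` into the symmetric difference, so the weight
    -- changes by `|T \ S| - |S ∩ T| ≤ 0`.
    have h1 : (Finset.univ.filter fun q => (e + χ) q ≠ 0) = (S \ T) ∪ (T \ S) := by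
      ext q
      have h01 : ∀ a : ZMod 2, a ≠ 0 ↔ a = 1 := by decide
      simp only [Finset.mem_filter, Finset.mem_univ, true_and, Finset.mem_union,
        Finset.mem_sdiff, hS, Pi.add_apply, hχ]
      by_cases hq : q ∈ T
      · simp only [hq, if_true, not_true, and_false, false_or, true_and]
        generalize e q = a
        revert a; decide
      · simp [hq]
    have h2 : (T.filter fun q => e q ≠ 0) = S ∩ T := by
      ext q; simp [hS, and_comm]
    rw [hammingNorm_eq_card_support, hammingNorm_eq_card_support, h1, ← hS,
      Finset.card_union_of_disjoint (by
        rw [Finset.disjoint_left]; intro a; simp; tauto)]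
    have h3 := Finset.card_sdiff_add_card_inter S T
    have h4 := Finset.card_sdiff_add_card_inter T S
    rw [Finset.inter_comm T S] at h4
    rw [h2] at h
    omega

/-! ### Bit-parallel bounds for the messages on a square patch

The bounds for an integer-valued function `g` on an `n × n` patch are packed in one natural
number: if the bit at position `t * (n * n) + (x + n * y)` is set, then `t - 8 ≤ g x y`. -/

/-- `G` encodes valid lower bounds of `g`. -/
def LowerBits (n : ℕ) (G : ℕ) (g : ℕ → ℕ → ℤ) : Prop :=
  ∀ t x y, x < n → y < n → G.testBit (t * (n * n) + (x + n * y)) = true → (t : ℤ) - 8 ≤ g x y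

/-- The number whose `i`-th bit is `f i` for `i < k`. -/
noncomputable def bitMask (f : ℕ → Bool) (k : ℕ) : ℕ :=
  Nat.rec 0 (fun k m => bif f k then 2 ^ k ||| m else m) k

theorem bitMask_succ (f : ℕ → Bool) (k : ℕ) :
    bitMask f (k + 1) = bif f k then 2 ^ k ||| bitMask f k else bitMask f k := rfl

theorem testBit_bitMask (f : ℕ → Bool) (k i : ℕ) :
    (bitMask f k).testBit i = (decide (i < k) && f i) := by
  induction k with
  | zero => simp [bitMask]
  | succ k ih =>
    rw [bitMask_succ]
    cases hf : f k
    · rw [cond_false, ih]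
      rcases eq_or_ne i k with rfl | hik
      · simp [hf]
      · have : i < k ↔ i < k + 1 := by omega
        simp [this]
    · rw [cond_true, Nat.testBit_or, ih, Nat.testBit_two_pow]
      rcases eq_or_ne i k with rfl | hik
      · simp [hf]
      · have : i < k ↔ i < k + 1 := by omega
        simp [this, hik.symm]

theorem patchIndex_mod {n x : ℕ} (t y : ℕ) (hx : x < n) :
    (t * (n * n) + (x + n * y)) % n = x := by
  have : t * (n * n) + (x + n * y) = x + n * (t * n + y) := by ring
  rw [this, Nat.add_mul_mod_self_left, Nat.mod_eq_of_lt hx]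

theorem patchIndex_lt {n x y : ℕ} (hx : x < n) (hy : y < n) : x + n * y < n * n := by
  have : n * y + n ≤ n * n := by
    rw [← Nat.mul_succ]; exact Nat.mul_le_mul_left _ hy
  omega

/-- The kernel evaluates these functions on literals directly. The definitions meant for evaluation
use them by name, and the proofs pass to the usual notation. -/
theorem natLand_eq (a b : ℕ) : Nat.land a b = a &&& b := rfl

theorem natLor_eq (a b : ℕ) : Nat.lor a b = a ||| b := rfl

theorem natXor_eq (a b : ℕ) : Nat.xor a b = a ^^^ b := rfl

theorem natShiftLeft_eq (a b : ℕ) : Nat.shiftLeft a b = a <<< b := rfl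

theorem natShiftRight_eq (a b : ℕ) : Nat.shiftRight a b = a >>> b := rfl

theorem natMul_eq (a b : ℕ) : Nat.mul a b = a * b := rfl

theorem natSub_eq (a b : ℕ) : Nat.sub a b = a - b := rfl

theorem natPow_eq (a b : ℕ) : Nat.pow a b = a ^ b := rfl

/-- Bounds on both sides: `l` encodes lower bounds for a function, and `n` for its opposite. -/
structure Bounds where
  l : ℕ
  n : ℕ

namespace Bounds

/-- The bounds are valid for the function `g`. -/
def Valid (n : ℕ) (B : Bounds) (g : ℕ → ℕ → ℤ) : Prop :=
  LowerBits n B.l g ∧ LowerBits n B.n fun x y => -g x y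

/-- Bounds for `minSum g h`. -/
def minSum (B C : Bounds) : Bounds :=
  ⟨Nat.lor (Nat.land B.l C.l) (Nat.land B.n C.n), Nat.lor (Nat.land B.n C.l) (Nat.land B.l C.n)⟩

/-- Bounds for the function with its sign changed on the set `D`, with complement `E`. -/
def flip (D E : ℕ) (B : Bounds) : Bounds :=
  ⟨Nat.lor (Nat.land B.l E) (Nat.land B.n D), Nat.lor (Nat.land B.n E) (Nat.land B.l D)⟩

/-- Bounds for `1 + g`. -/
def incr (N : ℕ) (B : Bounds) : Bounds :=
  ⟨Nat.lor (Nat.shiftLeft B.l N) B.l, Nat.shiftRight B.n N⟩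

end Bounds

section

variable {n : ℕ} {g h : ℕ → ℕ → ℤ}

theorem LowerBits.or {G H : ℕ} (hG : LowerBits n G g) (hH : LowerBits n H g) :
    LowerBits n (G ||| H) g := by
  intro t x y hx hy ht
  rw [Nat.testBit_or, Bool.or_eq_true] at ht
  exact ht.elim (hG t x y hx hy) (hH t x y hx hy)

theorem LowerBits.shiftRight {G : ℕ} (hG : LowerBits n G g) :
    LowerBits n (G >>> (n * n)) fun x y => g x y - 1 := by
  intro t x y hx hy ht
  rw [Nat.testBit_shiftRight] at ht
  have := hG (t + 1) x y hx hy (by rw [← ht]; congr 1; ring)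
  push_cast at this
  linarith

theorem LowerBits.shiftLeft {G : ℕ} (hG : LowerBits n G g) :
    LowerBits n (G <<< (n * n)) fun x y => 1 + g x y := by
  intro t x y hx hy ht
  rw [Nat.testBit_shiftLeft, Bool.and_eq_true, decide_eq_true_eq] at ht
  obtain ⟨h1, h2⟩ := ht
  have hlt := patchIndex_lt hx hy
  rcases t with _ | t
  · omega
  · have := hG t x y hx hy (by rw [← h2]; congr 1; rw [Nat.succ_mul]; omega)
    push_cast
    linarith

theorem LowerBits.mono {G : ℕ} (hG : LowerBits n G g) (hgh : ∀ x y, x < n → y < n → g x y ≤ h x y) :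
    LowerBits n G h := fun t x y hx hy ht => (hG t x y hx hy ht).trans (hgh x y hx hy)

/-- A maximum of two minima reaches a threshold if `g` and `h` both reach it or their opposites both
do, so one bitwise operation treats all cells and thresholds. -/
theorem LowerBits.minSum {l₁ n₁ l₂ n₂ : ℕ} (h₁ : LowerBits n l₁ g)
    (h₁' : LowerBits n n₁ fun x y => -g x y) (h₂ : LowerBits n l₂ h)
    (h₂' : LowerBits n n₂ fun x y => -h x y) :
    LowerBits n ((l₁ &&& l₂) ||| (n₁ &&& n₂)) fun x y => minSum (g x y) (h x y) := by
  intro t x y hx hy ht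
  simp only [Nat.testBit_or, Nat.testBit_and, Bool.or_eq_true, Bool.and_eq_true] at ht
  unfold _root_.minSum
  rcases ht with ⟨a, b⟩ | ⟨a, b⟩
  · exact le_max_of_le_left (le_min (h₁ t x y hx hy a) (h₂ t x y hx hy b))
  · exact le_max_of_le_right (le_min (h₁' t x y hx hy a) (h₂' t x y hx hy b))

theorem Bounds.Valid.minSum {B C : Bounds} (hB : B.Valid n g) (hC : C.Valid n h) :
    (B.minSum C).Valid n fun x y => _root_.minSum (g x y) (h x y) := by
  refine ⟨LowerBits.minSum hB.1 hB.2 hC.1 hC.2, ?_⟩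
  have := LowerBits.minSum (g := fun x y => -g x y) hB.2 (by simpa using hB.1) hC.1 hC.2
  simp only [minSum_neg_left] at this
  exact this

theorem Bounds.Valid.flip {B : Bounds} (hB : B.Valid n g) {D E : ℕ} {δ : ℕ → ℕ → Bool}
    (hD : ∀ t x y, x < n → y < n → D.testBit (t * (n * n) + (x + n * y)) = true → δ x y = true)
    (hE : ∀ t x y, x < n → y < n → E.testBit (t * (n * n) + (x + n * y)) = true → δ x y = false) :
    (B.flip D E).Valid n fun x y => (if δ x y = true then -1 else 1) * g x y := by
  constructor <;> intro t x y hx hy ht <;>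
    simp only [Bounds.flip, natLand_eq, natLor_eq, Nat.testBit_or, Nat.testBit_and, Bool.or_eq_true,
      Bool.and_eq_true] at ht <;>
    rcases ht with ⟨h1, h2⟩ | ⟨h1, h2⟩
  · simpa [hE t x y hx hy h2] using hB.1 t x y hx hy h1
  · simpa [hD t x y hx hy h2] using hB.2 t x y hx hy h1
  · simpa [hE t x y hx hy h2] using hB.2 t x y hx hy h1
  · simpa [hD t x y hx hy h2] using hB.1 t x y hx hy h1

/-- The shift by one level leaves level 0 empty; the old bits, still valid since `g ≤ 1 + g`, refill
it. -/
theorem Bounds.Valid.incr {B : Bounds} (hB : B.Valid n g) :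
    (B.incr (n * n)).Valid n fun x y => 1 + g x y := by
  refine ⟨LowerBits.or hB.1.shiftLeft (hB.1.mono fun x y _ _ => by linarith), ?_⟩
  · exact hB.2.shiftRight.mono fun x y _ _ => by linarith

/-- The number `m`, which has less than `N` bits, repeated `k` times. -/
noncomputable def repeatBits (N m k : ℕ) : ℕ :=
  Nat.rec 0 (fun _ r => r <<< N ||| m) k

theorem repeatBits_succ (N m k : ℕ) :
    repeatBits N m (k + 1) = repeatBits N m k <<< N ||| m := rfl

theorem testBit_repeatBits {N m : ℕ} (hm : m < 2 ^ N) (k t : ℕ) {j : ℕ} (hj : j < N) :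
    (repeatBits N m k).testBit (t * N + j) = (decide (t < k) && m.testBit j) := by
  induction k generalizing t with
  | zero => simp [repeatBits]
  | succ k ih =>
    rw [repeatBits_succ, Nat.testBit_or, Nat.testBit_shiftLeft]
    rcases t with _ | t
    · simp [hj]
    · have h1 : m.testBit ((t + 1) * N + j) = false :=
        Nat.testBit_lt_two_pow (hm.trans_le (Nat.pow_le_pow_right two_pos (by
          rw [Nat.succ_mul]; omega)))
      have h2 : (t + 1) * N + j - N = t * N + j := by rw [Nat.succ_mul]; omega
      have h3 : N ≤ (t + 1) * N + j := by rw [Nat.succ_mul]; omega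
      simp [h1, h2, h3, ih]

theorem bitMask_lt (f : ℕ → Bool) (k : ℕ) : bitMask f k < 2 ^ k := by
  refine Nat.lt_pow_two_of_testBit _ fun i hi => ?_
  rw [testBit_bitMask]
  simp [Nat.not_lt.mpr hi]

/-- The places of a set of cells of the patch, at all the first 16 levels. -/
noncomputable def cellMask (n : ℕ) (f : ℕ → ℕ → Bool) : ℕ :=
  repeatBits (n * n) (bitMask (fun i => f (i % n) (i / n)) (n * n)) 16

/-- Levels from 16 on are cleared, which is sound since a clear bit asserts nothing. The cut keeps
the bounds in a finite range, so that they can recur although messages far from the defects keep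
growing. -/
theorem testBit_cellMask (f : ℕ → ℕ → Bool) {t x y : ℕ} (hx : x < n) (hy : y < n) :
    (cellMask n f).testBit (t * (n * n) + (x + n * y)) = (decide (t < 16) && f x y) := by
  have hlt := patchIndex_lt hx hy
  rw [cellMask, testBit_repeatBits (bitMask_lt _ _) _ _ hlt, testBit_bitMask]
  have h1 := patchIndex_mod 0 y hx
  have h2 : (x + n * y) / n = y := by
    rw [Nat.add_mul_div_left _ _ (by omega), Nat.div_eq_of_lt hx, zero_add]
  rw [zero_mul, zero_add] at h1
  simp [h1, h2, hlt]

/-- The bits of `A` on a set `K` of cells, and those of `B` on the complement `K'`. -/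
def select (K K' A B : ℕ) : ℕ := Nat.lor (Nat.land A K) (Nat.land B K')

theorem testBit_select {K K' A B i : ℕ} (h : (select K K' A B).testBit i = true) :
    A.testBit i = true ∧ K.testBit i = true ∨ B.testBit i = true ∧ K'.testBit i = true := by
  simpa [select, natLand_eq, natLor_eq] using h

end

/-! ### The patch -/

/-- An `n × n` patch in a graph with four directions. If `w = true` then the patch is closed up
to a torus. -/
structure IsPatch {V : Type*} (nb : V → Dir → V) (n : ℕ) (w : Bool) (ι : ℕ → ℕ → V) : Prop where
  pos : 0 < n
  opp : ∀ v d, nb (nb v d) d.opp = v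
  right : ∀ x y, x + 1 < n → y < n → nb (ι x y) (false, true) = ι (x + 1) y
  up : ∀ x y, x < n → y + 1 < n → nb (ι x y) (true, true) = ι x (y + 1)
  inj : ∀ x y x' y', x < n → y < n → x' < n → y' < n → ι x y = ι x' y' → x = x' ∧ y = y'
  wrapRight : w = true → ∀ y, y < n → nb (ι (n - 1) y) (false, true) = ι 0 y
  wrapUp : w = true → ∀ x, x < n → nb (ι x (n - 1)) (true, true) = ι x 0

/-- The cells of the patch on the side of the direction `d`. -/
def side (n : ℕ) (d : Dir) (x y : ℕ) : Bool :=
  match d with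
  | (false, true) => x + 1 == n
  | (false, false) => x == 0
  | (true, true) => y + 1 == n
  | (true, false) => y == 0

/-- `G` shifted by one cell: the bit at a cell is that of its neighbour in direction `d`. -/
def shiftTo (n : ℕ) (d : Dir) (G : ℕ) : ℕ :=
  match d with
  | (false, true) => Nat.shiftRight G 1
  | (false, false) => Nat.shiftLeft G 1
  | (true, true) => Nat.shiftRight G n
  | (true, false) => Nat.shiftLeft G n

/-- The bits of `G` on the opposite side of the patch. -/
def wrapTo (n : ℕ) (d : Dir) (G : ℕ) : ℕ :=
  match d with
  | (false, true) => G <<< (n - 1)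
  | (false, false) => G >>> (n - 1)
  | (true, true) => G <<< (n * (n - 1))
  | (true, false) => G >>> (n * (n - 1))

/-- Coordinates of the neighbouring cell. -/
def cellNext (d : Dir) (x y : ℕ) : ℕ × ℕ :=
  match d with
  | (false, true) => (x + 1, y)
  | (false, false) => (x - 1, y)
  | (true, true) => (x, y + 1)
  | (true, false) => (x, y - 1)

/-- Coordinates of the cell on the opposite side. -/
def cellWrap (n : ℕ) (d : Dir) (x y : ℕ) : ℕ × ℕ :=
  match d with
  | (false, true) => (0, y)
  | (false, false) => (n - 1, y)
  | (true, true) => (x, 0)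
  | (true, false) => (x, n - 1)

section

variable {n : ℕ}

/-- Neighbouring cells are 1 apart in a row and `n` apart in a column. The bits that a shift carries
into another row or level land on the excluded side. -/
theorem testBit_shiftTo {d : Dir} {G t x y : ℕ}
    (hs : side n d x y = false)
    (h : (shiftTo n d G).testBit (t * (n * n) + (x + n * y)) = true) :
    G.testBit (t * (n * n) + ((cellNext d x y).1 + n * (cellNext d x y).2)) = true := by
  rcases d with ⟨_ | _, _ | _⟩ <;>
    simp only [shiftTo, side, cellNext, natShiftRight_eq, natShiftLeft_eq,
      Nat.testBit_shiftRight, Nat.testBit_shiftLeft,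
      Bool.and_eq_true, decide_eq_true_eq, beq_eq_false_iff_ne] at h hs ⊢
  · rw [← h.2]; congr 1; omega
  · rw [← h]; congr 1; omega
  · obtain ⟨y, rfl⟩ := Nat.exists_eq_succ_of_ne_zero hs
    rw [← h.2]; congr 1; rw [Nat.mul_succ]; simp; omega
  · rw [← h]; congr 1; ring

/-- Opposite sides are `n - 1` apart within a row, and `n * (n - 1)` apart within a column. -/
theorem testBit_wrapTo {d : Dir} {G t x y : ℕ} (hn : 0 < n)
    (hs : side n d x y = true)
    (h : (wrapTo n d G).testBit (t * (n * n) + (x + n * y)) = true) :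
    G.testBit (t * (n * n) + ((cellWrap n d x y).1 + n * (cellWrap n d x y).2)) = true := by
  rcases d with ⟨_ | _, _ | _⟩ <;>
    simp only [wrapTo, side, cellWrap, Nat.testBit_shiftRight, Nat.testBit_shiftLeft,
      Bool.and_eq_true, decide_eq_true_eq, beq_iff_eq] at h hs ⊢
  · rw [← h]; congr 1; omega
  · rw [← h.2]; congr 1; omega
  · rw [← h]; congr 1; subst hs; ring
  · rw [← h.2]; congr 1
    obtain rfl : y = n - 1 := by omega
    simp; omega

theorem cellNext_lt {d : Dir} {x y : ℕ} (hx : x < n) (hy : y < n) (hs : side n d x y = false) :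
    (cellNext d x y).1 < n ∧ (cellNext d x y).2 < n := by
  rcases d with ⟨_ | _, _ | _⟩ <;> simp [side, cellNext] at hs ⊢ <;> omega

theorem cellWrap_lt {d : Dir} {x y : ℕ} (hx : x < n) (hy : y < n) :
    (cellWrap n d x y).1 < n ∧ (cellWrap n d x y).2 < n := by
  rcases d with ⟨_ | _, _ | _⟩ <;> simp [cellWrap] <;> omega

variable {V : Type*} {nb : V → Dir → V} {w : Bool} {ι : ℕ → ℕ → V}

theorem IsPatch.next (hP : IsPatch nb n w ι) {d : Dir} {x y : ℕ} (hx : x < n) (hy : y < n)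
    (hs : side n d x y = false) :
    nb (ι x y) d = ι (cellNext d x y).1 (cellNext d x y).2 := by
  rcases d with ⟨_ | _, _ | _⟩ <;> simp [side, cellNext] at hs ⊢
  · obtain ⟨x, rfl⟩ := Nat.exists_eq_succ_of_ne_zero hs
    have := hP.opp (ι x y) (false, true)
    rwa [hP.right x y hx hy] at this
  · exact hP.right x y (by omega) hy
  · obtain ⟨y, rfl⟩ := Nat.exists_eq_succ_of_ne_zero hs
    have := hP.opp (ι x y) (true, true)
    rwa [hP.up x y hx hy] at this
  · exact hP.up x y hx (by omega)

theorem IsPatch.wrap (hP : IsPatch nb n w ι) (hw : w = true) {d : Dir} {x y : ℕ} (hx : x < n)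
    (hy : y < n) (hs : side n d x y = true) :
    nb (ι x y) d = ι (cellWrap n d x y).1 (cellWrap n d x y).2 := by
  rcases d with ⟨_ | _, _ | _⟩ <;> simp [side, cellWrap] at hs ⊢
  · have := hP.opp (ι (n - 1) y) (false, true)
    rw [hP.wrapRight hw y hy] at this
    rwa [hs]
  · obtain rfl : x = n - 1 := by omega
    exact hP.wrapRight hw y hy
  · have := hP.opp (ι x (n - 1)) (true, true)
    rw [hP.wrapUp hw x hx] at this
    rwa [hs]
  · obtain rfl : y = n - 1 := by omega
    exact hP.wrapUp hw x hx

/-- A neighbour of a cell on the side of the patch is a cell only if that one is on the opposite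
side. -/
theorem IsPatch.side_opp (hP : IsPatch nb n w ι) {d : Dir} {x y x' y' : ℕ} (hx : x < n)
    (hy : y < n) (hx' : x' < n) (hy' : y' < n) (hs : side n d x y = true)
    (h : nb (ι x y) d = ι x' y') : side n d.opp x' y' = true := by
  by_contra hs'
  rw [Bool.not_eq_true] at hs'
  have h1 := hP.next hx' hy' hs'
  rw [← h, hP.opp] at h1
  have h2 := cellNext_lt hx' hy' hs'
  have h3 := hP.inj _ _ _ _ hx hy h2.1 h2.2 h1
  rcases d with ⟨_ | _, _ | _⟩ <;>
    simp only [Dir.opp, Bool.not_true, Bool.not_false] at h3 hs' <;>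
    simp [side, cellNext] at hs h3 hs' <;> omega

end

/-- Bounds for the messages that leave the cells of a patch in each direction. If the patch is not
closed up, then `M - 9` is a lower bound for all the other messages, and for those that leave the
patch. -/
structure PatchState where
  b00 : Bounds
  b01 : Bounds
  b10 : Bounds
  b11 : Bounds
  M : ℕ

/-- The bounds for the messages in direction `d`. -/
def PatchState.out (S : PatchState) (d : Dir) : Bounds :=
  match d with
  | (false, false) => S.b00
  | (false, true) => S.b01
  | (true, false) => S.b10
  | (true, true) => S.b11

/-- Fixed data of a computation on a patch: its size `n`, its number `N` of cells, the mask of all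
the cells, whether it is closed up, the masks of the
sides and of their complements, and those of the defects and of their complement. -/
structure PatchData where
  n : ℕ
  N : ℕ
  full : ℕ
  w : Bool
  sides : Dir → ℕ
  cosides : Dir → ℕ
  D : ℕ
  E : ℕ

namespace PatchData

variable (A : PatchData) (S : PatchState)

/-- Bounds for the messages that reach the cells from direction `d`. -/
def into (d : Dir) : Bounds :=
  ⟨select (A.cosides d) (A.sides d) (shiftTo A.n d (S.out d.opp).l)
      (bif A.w then wrapTo A.n d (S.out d.opp).l else Nat.sub (Nat.pow 2 (Nat.mul S.M A.N)) 1),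
    select (A.cosides d) (A.sides d) (shiftTo A.n d (S.out d.opp).n)
      (bif A.w then wrapTo A.n d (S.out d.opp).n else 0)⟩

/-- Bounds for the messages in direction `d` at the next iteration. -/
def next (d : Dir) : Bounds :=
  (((A.into S (d.1, !d.2)).minSum
    ((A.into S (!d.1, true)).minSum (A.into S (!d.1, false)))).flip A.D A.E).incr A.N

/-- Whether `k - 9` is a lower bound for the messages `B` that leave the patch in
direction `d`. -/
def exitBound (B : Bounds) (d : Dir) (k : ℕ) : Bool :=
  Nat.beq (Nat.land (Nat.land (A.sides d) A.full) (Nat.shiftRight B.l (Nat.mul (Nat.sub k 1) A.N)))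
    (Nat.land (A.sides d) A.full)

/-- The largest `k' ≤ k` with `p k'`, or `0`. -/
noncomputable def searchDown (p : ℕ → Bool) (k : ℕ) : ℕ :=
  Nat.rec 0 (fun k r => bif p (k + 1) then k + 1 else r) k

theorem searchDown_succ (p : ℕ → Bool) (k : ℕ) :
    searchDown p (k + 1) = bif p (k + 1) then k + 1 else searchDown p k := rfl

/-- `f k`, with `k` evaluated first. -/
noncomputable def withNat {α : Type*} (k : ℕ) (f : ℕ → α) : α :=
  Nat.rec (f 0) (fun k _ => f (Nat.succ k)) k

theorem withNat_eq {α : Type*} (k : ℕ) (f : ℕ → α) : withNat k f = f k := by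
  cases k <;> rfl

/-- `f B`, with `B` evaluated first. -/
noncomputable def withBounds {α : Type*} (B : Bounds) (f : Bounds → α) : α :=
  withNat B.l fun l => withNat B.n fun n => f ⟨l, n⟩

theorem withBounds_eq {α : Type*} (B : Bounds) (f : Bounds → α) : withBounds B f = f B := by
  simp [withBounds, withNat_eq]

/-- A lower bound at the next iteration for the messages that do not start in the patch or that
leave it. -/
noncomputable def nextM (out : Dir → Bounds) : ℕ :=
  searchDown (fun k => A.exitBound (out (false, false)) (false, false) k &&
    A.exitBound (out (false, true)) (false, true) k &&
    A.exitBound (out (true, false)) (true, false) k &&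
    A.exitBound (out (true, true)) (true, true) k) (S.M + 1)

/-- The state of the patch at the next iteration, passed to `f`. -/
noncomputable def withStep {α : Type*} (f : PatchState → α) : α :=
  withBounds (A.into S (false, false)) fun i00 =>
  withBounds (A.into S (false, true)) fun i01 =>
  withBounds (A.into S (true, false)) fun i10 =>
  withBounds (A.into S (true, true)) fun i11 =>
  withBounds (i01.minSum i00) fun h =>
  withBounds (i11.minSum i10) fun v =>
  withBounds (i01.minSum v) fun o00 =>
  withBounds (i00.minSum v) fun o01 =>
  withBounds (i11.minSum h) fun o10 =>
  withBounds (i10.minSum h) fun o11 =>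
  withBounds ((o00.flip A.D A.E).incr A.N) fun b00 =>
  withBounds ((o01.flip A.D A.E).incr A.N) fun b01 =>
  withBounds ((o10.flip A.D A.E).incr A.N) fun b10 =>
  withBounds ((o11.flip A.D A.E).incr A.N) fun b11 =>
  withNat (bif A.w then 10 else A.nextM S (PatchState.mk b00 b01 b10 b11 0).out) fun M =>
  f ⟨b00, b01, b10, b11, M⟩

/-- The state of the patch at the next iteration. -/
noncomputable def step : PatchState :=
  ⟨A.next S (false, false), A.next S (false, true), A.next S (true, false), A.next S (true, true),
    bif A.w then 10 else A.nextM S (A.next S)⟩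

theorem withStep_eq {α : Type*} (f : PatchState → α) : A.withStep S f = f (A.step S) := by
  simp only [withStep, withBounds_eq, withNat_eq]
  rfl

/-- The cells at which `a ≥ t - 8` and `b ≥ k - t - 8` for some `t`. -/
noncomputable def levelMeet (N k a b : ℕ) (l : List ℕ) : ℕ :=
  List.rec 0 (fun t _ r => Nat.lor (Nat.land (Nat.shiftRight a (Nat.mul t N))
    (Nat.shiftRight b (Nat.mul (Nat.sub k t) N))) r) l

theorem levelMeet_cons (N k a b t : ℕ) (l : List ℕ) : levelMeet N k a b (t :: l) =
    ((a >>> (t * N)) &&& (b >>> ((k - t) * N))) ||| levelMeet N k a b l := rfl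

/-- Cells at which the edge in direction `d` certainly has a negative a posteriori value. -/
noncomputable def neg (d : Dir) : ℕ :=
  withBounds (A.into S d) fun I => levelMeet A.N 16 (S.out d).n I.n [5, 6, 7, 8, 9, 10, 11]

/-- Cells at which the edge in direction `d` certainly has a positive a posteriori value. -/
noncomputable def pos (d : Dir) : ℕ :=
  withBounds (A.into S d) fun I => levelMeet A.N 18 (S.out d).l I.l [6, 7, 8, 9, 10, 11, 12]

/-- Whether there is a cell at which the estimated error certainly violates the syndrome. -/
noncomputable def conflict : Bool :=
  withNat (A.neg S (false, false)) fun n00 =>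
  withNat (A.neg S (false, true)) fun n01 =>
  withNat (A.neg S (true, false)) fun n10 =>
  withNat (A.neg S (true, true)) fun n11 =>
  withNat (A.pos S (false, false)) fun p00 =>
  withNat (A.pos S (false, true)) fun p01 =>
  withNat (A.pos S (true, false)) fun p10 =>
  withNat (A.pos S (true, true)) fun p11 =>
  !Nat.beq (Nat.land A.full (Nat.land
    (Nat.land (Nat.land (Nat.lor n00 p00) (Nat.lor n01 p01))
      (Nat.land (Nat.lor n10 p10) (Nat.lor n11 p11)))
    (Nat.xor (Nat.xor (Nat.xor n00 n01) (Nat.xor n10 n11)) A.D))) 0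

/-- Whether, at the cells of the patch, the edges in direction `d` with a negative a posteriori
value are certainly those of the mask `p`, the others being positive. -/
noncomputable def agrees (d : Dir) (p : ℕ) : Bool :=
  Nat.beq (Nat.land p (A.neg S d)) p && Nat.beq (Nat.land (Nat.lor (A.pos S d) p) A.full) A.full

/-- The masks of the data are correct. -/
structure Valid (δ : ℕ → ℕ → Bool) : Prop where
  N : A.N = A.n * A.n
  full : A.full = 2 ^ (A.n * A.n) - 1
  sides : ∀ d, A.sides d = cellMask A.n (side A.n d)
  cosides : ∀ d, A.cosides d = cellMask A.n (fun x y => !side A.n d x y)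
  D : ∀ t x y, x < A.n → y < A.n →
    A.D.testBit (t * (A.n * A.n) + (x + A.n * y)) = (decide (t < 16) && δ x y)
  E : A.E = A.D ^^^ (2 ^ (16 * (A.n * A.n)) - 1)

end PatchData

/-- The state of the patch at the beginning. -/
def PatchState.init (n : ℕ) : PatchState :=
  let B : Bounds := ⟨2 ^ (10 * (n * n)) - 1, 2 ^ (8 * (n * n)) - 1⟩
  ⟨B, B, B, B, 10⟩

/-- The state `S` gives valid bounds for the messages at iteration `i`. -/
structure PatchState.Valid {V : Type*} (nb : V → Dir → V) (s : V → Bool) (n : ℕ) (w : Bool)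
    (ι : ℕ → ℕ → V) (S : PatchState) (i : ℕ) : Prop where
  out : ∀ d, (S.out d).Valid n fun x y => caMsg nb s i (ι x y) d
  ten_le : 10 ≤ S.M
  outside : w = false → ∀ v, (∀ x y, x < n → y < n → v ≠ ι x y) → ∀ d,
    (S.M : ℤ) - 9 ≤ caMsg nb s i v d
  exit : w = false → ∀ d x y, x < n → y < n → side n d x y = true →
    (S.M : ℤ) - 9 ≤ caMsg nb s i (ι x y) d

/-! ### Soundness of the propagated bounds -/

section

variable {V : Type*} {nb : V → Dir → V} {s : V → Bool} {A : PatchData} {ι : ℕ → ℕ → V}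
  {S : PatchState} {i : ℕ} {δ : ℕ → ℕ → Bool}

/-- The highest of `c` full levels is `c - 1`, which encodes the threshold `c - 9`. This is why the
bound outside the patch reads `M - 9`. -/
theorem lowerBits_two_pow_sub_one {n : ℕ} {c : ℕ} {g : ℕ → ℕ → ℤ}
    (h : ∀ x y, x < n → y < n → (c : ℤ) - 9 ≤ g x y) : LowerBits n (2 ^ (c * (n * n)) - 1) g := by
  intro t x y hx hy ht
  rw [Nat.testBit_two_pow_sub_one, decide_eq_true_eq] at ht
  have : t < c := by
    by_contra hc
    have : c * (n * n) ≤ t * (n * n) := Nat.mul_le_mul_right _ (by omega)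
    omega
  have := h x y hx hy
  omega

theorem PatchState.init_valid (n : ℕ) (w : Bool) :
    (PatchState.init n).Valid nb s n w ι 0 where
  out d := by
    have : (PatchState.init n).out d = ⟨2 ^ (10 * (n * n)) - 1, 2 ^ (8 * (n * n)) - 1⟩ := by
      rcases d with ⟨_ | _, _ | _⟩ <;> rfl
    rw [this]
    constructor
    -- Ten full levels say `1 ≤ g`, and eight say `-1 ≤ -g`; together they describe the initial
    -- message 1.
    · exact lowerBits_two_pow_sub_one (c := 10) fun x y _ _ => by simp [caMsg]
    · exact lowerBits_two_pow_sub_one (c := 8) fun x y _ _ => by simp [caMsg]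
  ten_le := le_rfl
  outside _ v _ d := by simp [PatchState.init, caMsg]
  exit _ d x y _ _ _ := by simp [PatchState.init, caMsg]

theorem PatchData.into_valid (hP : IsPatch nb A.n A.w ι) (hA : A.Valid δ)
    (hS : S.Valid nb s A.n A.w ι i) (d : Dir) :
    (A.into S d).Valid A.n fun x y => caMsg nb s i (nb (ι x y) d) d.opp := by
  have hopp := hS.out d.opp
  constructor <;> intro t x y hx hy ht <;> simp only [PatchData.into] at ht <;>
    beta_reduce <;> rcases testBit_select ht with ⟨h1, h2⟩ | ⟨h1, h2⟩
  · rw [hA.cosides, testBit_cellMask _ hx hy] at h2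
    simp only [Bool.and_eq_true, Bool.not_eq_true'] at h2
    rw [hP.next hx hy h2.2]
    have h3 := cellNext_lt hx hy h2.2
    exact hopp.1 t _ _ h3.1 h3.2 (testBit_shiftTo h2.2 h1)
  · rw [hA.sides, testBit_cellMask _ hx hy, Bool.and_eq_true] at h2
    cases hw : A.w
    · rw [hw, cond_false, hA.N, natPow_eq, natSub_eq, natMul_eq, Nat.testBit_two_pow_sub_one,
        decide_eq_true_eq] at h1
      have ht : t < S.M := by
        by_contra hc
        have : S.M * (A.n * A.n) ≤ t * (A.n * A.n) := Nat.mul_le_mul_right _ (by omega)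
        omega
      have : (S.M : ℤ) - 9 ≤ caMsg nb s i (nb (ι x y) d) d.opp := by
        -- An open patch with `n = L` meets itself: the neighbour may be a cell of the opposite
        -- side, and its message back is then one that leaves the patch, which `exit` bounds.
        by_cases hr : ∃ x' y', x' < A.n ∧ y' < A.n ∧ nb (ι x y) d = ι x' y'
        · obtain ⟨x', y', hx', hy', hr⟩ := hr
          rw [hr]
          exact hS.exit hw _ _ _ hx' hy' (hP.side_opp hx hy hx' hy' h2.2 hr)
        · push Not at hr
          exact hS.outside hw _ (fun x' y' hx' hy' => hr x' y' hx' hy') _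
      omega
    · rw [hw, cond_true] at h1
      rw [hP.wrap hw hx hy h2.2]
      have h3 := cellWrap_lt (d := d) hx hy
      exact hopp.1 t _ _ h3.1 h3.2 (testBit_wrapTo hP.pos h2.2 h1)
  · rw [hA.cosides, testBit_cellMask _ hx hy] at h2
    simp only [Bool.and_eq_true, Bool.not_eq_true'] at h2
    rw [hP.next hx hy h2.2]
    have h3 := cellNext_lt hx hy h2.2
    exact hopp.2 t _ _ h3.1 h3.2 (testBit_shiftTo h2.2 h1)
  · rw [hA.sides, testBit_cellMask _ hx hy, Bool.and_eq_true] at h2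
    cases hw : A.w
    · simp [hw] at h1
    · rw [hw, cond_true] at h1
      rw [hP.wrap hw hx hy h2.2]
      have h3 := cellWrap_lt (d := d) hx hy
      exact hopp.2 t _ _ h3.1 h3.2 (testBit_wrapTo hP.pos h2.2 h1)

theorem PatchData.next_valid (hP : IsPatch nb A.n A.w ι) (hA : A.Valid δ)
    (hδ : ∀ x y, x < A.n → y < A.n → s (ι x y) = δ x y) (hS : S.Valid nb s A.n A.w ι i) (d : Dir) :
    (A.next S d).Valid A.n fun x y => caMsg nb s (i + 1) (ι x y) d := by
  have h1 := PatchData.into_valid hP hA hS (d.1, !d.2)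
  have h2 := PatchData.into_valid hP hA hS (!d.1, true)
  have h3 := PatchData.into_valid hP hA hS (!d.1, false)
  rw [PatchData.next, hA.N]
  have h4 := ((h1.minSum (h2.minSum h3)).flip (D := A.D) (E := A.E) (δ := δ) ?_ ?_).incr
  · have hcongr : ∀ {B : Bounds} {g h : ℕ → ℕ → ℤ}, B.Valid A.n g →
        (∀ x y, x < A.n → y < A.n → g x y = h x y) → B.Valid A.n h := fun hB hgh =>
      ⟨hB.1.mono fun x y hx hy => (hgh x y hx hy).le,
        hB.2.mono fun x y hx hy => by rw [hgh x y hx hy]⟩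
    refine hcongr h4 fun x y hx hy => ?_
    simp only [caMsg, hδ x y hx hy, Dir.opp, Bool.not_not, Bool.not_true, Bool.not_false]
  · intro t x y hx hy ht
    rw [hA.D t x y hx hy, Bool.and_eq_true] at ht
    exact ht.2
  · intro t x y hx hy ht
    have hD := hA.D t x y hx hy
    have hlt := patchIndex_lt hx hy
    rw [hA.E, Nat.testBit_xor, Nat.testBit_two_pow_sub_one, hD] at ht
    -- `E` is the complement of `D` on the first 16 levels, and both are clear above.
    by_cases h16 : t < 16
    · have : t * (A.n * A.n) + (x + A.n * y) < 16 * (A.n * A.n) := by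
        have : (t + 1) * (A.n * A.n) ≤ 16 * (A.n * A.n) := Nat.mul_le_mul_right _ (by omega)
        rw [Nat.succ_mul] at this
        omega
      simpa [h16, this] using ht
    · have : ¬ t * (A.n * A.n) + (x + A.n * y) < 16 * (A.n * A.n) := by
        have : 16 * (A.n * A.n) ≤ t * (A.n * A.n) := Nat.mul_le_mul_right _ (by omega)
        omega
      simp [h16, this] at ht

theorem PatchData.searchDown_spec (p : ℕ → Bool) (k : ℕ) :
    PatchData.searchDown p k ≤ k ∧
      (PatchData.searchDown p k ≠ 0 → p (PatchData.searchDown p k) = true) := by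
  induction k with
  | zero => simp [PatchData.searchDown]
  | succ k ih =>
    rw [PatchData.searchDown_succ]
    cases h : p (k + 1)
    · exact ⟨by simpa using ih.1.trans (Nat.le_succ k), by simpa using ih.2⟩
    · simp [h]

theorem PatchData.exitBound_spec {B : Bounds} {g : ℕ → ℕ → ℤ} (hA : A.Valid δ)
    (hB : B.Valid A.n g) {d : Dir} {k : ℕ} (h : A.exitBound B d k = true) {x y : ℕ}
    (hx : x < A.n) (hy : y < A.n) (hs : side A.n d x y = true) : (k : ℤ) - 9 ≤ g x y := by
  rw [PatchData.exitBound, Nat.beq_eq] at h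
  have h1 := congrArg (fun m => m.testBit (x + A.n * y)) h
  have h2 := testBit_cellMask (n := A.n) (side A.n d) (t := 0) hx hy
  rw [zero_mul, zero_add] at h2
  simp only [natLand_eq, natShiftRight_eq, natSub_eq, natMul_eq, Nat.testBit_and, hA.sides,
    hA.full, hA.N, h2, hs, Nat.testBit_two_pow_sub_one,
    patchIndex_lt hx hy, Nat.testBit_shiftRight] at h1
  have := hB.1 (k - 1) x y hx hy (by simpa using h1)
  omega

/-- The bounds computed for the next iteration are valid. -/
theorem PatchData.step_valid (hP : IsPatch nb A.n A.w ι) (hA : A.Valid δ)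
    (hδ : ∀ x y, x < A.n → y < A.n → s (ι x y) = δ x y)
    (hout : ∀ v, (∀ x y, x < A.n → y < A.n → v ≠ ι x y) → s v = false)
    (hS : S.Valid nb s A.n A.w ι i) (hM : 10 ≤ (A.step S).M) :
    (A.step S).Valid nb s A.n A.w ι (i + 1) := by
  have hnext := PatchData.next_valid hP hA hδ hS
  have hMw : A.w = false → (A.step S).M = A.nextM S (A.next S) := fun hw => by
    simp [PatchData.step, hw]
  have hspec := PatchData.searchDown_spec (fun k =>
    A.exitBound (A.next S (false, false)) (false, false) k &&
    A.exitBound (A.next S (false, true)) (false, true) k &&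
    A.exitBound (A.next S (true, false)) (true, false) k &&
    A.exitBound (A.next S (true, true)) (true, true) k) (S.M + 1)
  rw [← PatchData.nextM] at hspec
  refine ⟨fun d => ?_, hM, fun hw v hv d => ?_, fun hw d x y hx hy hs => ?_⟩
  · have : (A.step S).out d = A.next S d := by rcases d with ⟨_ | _, _ | _⟩ <;> rfl
    rw [this]
    exact hnext d
  -- A message that reaches a vertex outside the patch either starts outside or leaves the patch.
  · have key : ∀ k : Dir, (S.M : ℤ) - 9 ≤ caMsg nb s i (nb v k) k.opp := by
      intro k
      by_cases hr : ∃ x y, x < A.n ∧ y < A.n ∧ nb v k = ι x y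
      · obtain ⟨x, y, hx, hy, hr⟩ := hr
        rw [hr]
        refine hS.exit hw _ _ _ hx hy ?_
        by_contra hs
        rw [Bool.not_eq_true] at hs
        have h1 := hP.next hx hy hs
        rw [← hr, hP.opp] at h1
        have h2 := cellNext_lt hx hy hs
        exact hv _ _ h2.1 h2.2 h1
      · push Not at hr
        exact hS.outside hw _ (fun x' y' hx' hy' => hr x' y' hx' hy') _
    have k1 := key (d.1, !d.2)
    have k2 := key (!d.1, true)
    have k3 := key (!d.1, false)
    simp only [Dir.opp, Bool.not_not, Bool.not_true, Bool.not_false] at k1 k2 k3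
    have h10 := hS.ten_le
    have hle := hspec.1
    rw [← hMw hw] at hle
    -- There is no defect at `v` and the three incoming messages are at least `M - 9 ≥ 1`, so their
    -- `minSum` is their minimum and the new message is at least `M - 8`.
    simp only [caMsg, hout v hv, Bool.false_eq_true, if_false, one_mul, minSum]
    have : (d.1, d.2) = d := rfl
    rw [this] at k1
    omega
  · rw [hMw hw] at hM ⊢
    have hk : A.nextM S (A.next S) ≠ 0 := by omega
    have h1 := hspec.2 hk
    simp only [Bool.and_eq_true] at h1
    refine PatchData.exitBound_spec hA (hnext d) ?_ hx hy hs
    rcases d with ⟨_ | _, _ | _⟩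
    exacts [h1.1.1.1, h1.1.1.2, h1.1.2, h1.2]

/-- Each level is offset by 8, so levels `t` and `k - t` together give the threshold `k - 16`. The
list contains only some of the splittings of `k`, which is enough for a sufficient test. -/
theorem PatchData.levelMeet_spec {n k a b : ℕ} {g h : ℕ → ℕ → ℤ} (ha : LowerBits n a g)
    (hb : LowerBits n b h) (l : List ℕ) {x y : ℕ} (hx : x < n) (hy : y < n)
    (ht : (PatchData.levelMeet (n * n) k a b l).testBit (x + n * y) = true) :
    (k : ℤ) - 16 ≤ g x y + h x y := by
  induction l with
  | nil => simp [PatchData.levelMeet] at ht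
  | cons t l ih =>
    rw [PatchData.levelMeet_cons] at ht
    simp only [Nat.testBit_or, Nat.testBit_and, Nat.testBit_shiftRight,
      Bool.or_eq_true, Bool.and_eq_true] at ht
    rcases ht with ⟨h1, h2⟩ | ht
    · have := ha _ _ _ hx hy h1
      have := hb _ _ _ hx hy h2
      omega
    · exact ih ht

/-- With `k = 16` the two messages have sum at most 0, and the a posteriori value is this sum minus
1. -/
theorem PatchData.neg_spec (hP : IsPatch nb A.n A.w ι) (hA : A.Valid δ)
    (hS : S.Valid nb s A.n A.w ι i) {d : Dir} {x y : ℕ} (hx : x < A.n) (hy : y < A.n)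
    (h : (A.neg S d).testBit (x + A.n * y) = true) : caApp nb s i (ι x y) d < 0 := by
  rw [PatchData.neg, PatchData.withBounds_eq, hA.N] at h
  have := PatchData.levelMeet_spec (hS.out d).2 (PatchData.into_valid hP hA hS d).2 _ hx hy h
  simp only [caApp]
  push_cast at this
  linarith

/-- With `k = 18` the two messages have sum at least 2. -/
theorem PatchData.pos_spec (hP : IsPatch nb A.n A.w ι) (hA : A.Valid δ)
    (hS : S.Valid nb s A.n A.w ι i) {d : Dir} {x y : ℕ} (hx : x < A.n) (hy : y < A.n)
    (h : (A.pos S d).testBit (x + A.n * y) = true) : 0 < caApp nb s i (ι x y) d := by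
  rw [PatchData.pos, PatchData.withBounds_eq, hA.N] at h
  have := PatchData.levelMeet_spec (hS.out d).1 (PatchData.into_valid hP hA hS d).1 _ hx hy h
  simp only [caApp]
  push_cast at this
  linarith

/-- A set bit of the mask is a cell where all four a posteriori values have a strict sign and the
parity of the negative ones is not the syndrome. -/
theorem PatchData.conflict_spec (hP : IsPatch nb A.n A.w ι) (hA : A.Valid δ)
    (hS : S.Valid nb s A.n A.w ι i) (h : A.conflict S = true) :
    ∃ x y, x < A.n ∧ y < A.n ∧ ∃ f : Dir → Bool,
      (∀ d, if f d = true then caApp nb s i (ι x y) d < 0 else 0 < caApp nb s i (ι x y) d) ∧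
      (xor (f (false, false)) (xor (f (false, true)) (xor (f (true, false)) (f (true, true))))) ≠
        δ x y := by
  simp only [PatchData.conflict, PatchData.withNat_eq, Bool.not_eq_true',
    natLand_eq, natLor_eq, natXor_eq, hA.full] at h
  obtain ⟨j, hj⟩ := Nat.exists_testBit_of_ne_zero (Nat.ne_of_beq_eq_false h)
  rw [Nat.testBit_and, Nat.testBit_two_pow_sub_one, Bool.and_eq_true, decide_eq_true_eq] at hj
  obtain ⟨hjn, hj⟩ := hj
  have hn := hP.pos
  have hx : j % A.n < A.n := Nat.mod_lt _ hn
  have hy : j / A.n < A.n := Nat.div_lt_of_lt_mul hjn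
  have hxy : j % A.n + A.n * (j / A.n) = j := Nat.mod_add_div _ _
  refine ⟨j % A.n, j / A.n, hx, hy, fun d => (A.neg S d).testBit j, fun d => ?_, ?_⟩
  · have hneg := PatchData.neg_spec hP hA hS (d := d) hx hy
    have hpos := PatchData.pos_spec hP hA hS (d := d) hx hy
    rw [hxy] at hneg hpos
    simp only [Nat.testBit_and, Nat.testBit_or, Bool.and_eq_true, Bool.or_eq_true] at hj
    split_ifs with hf
    · exact hneg hf
    · refine hpos ?_
      rcases d with ⟨_ | _, _ | _⟩ <;> simp_all
  · have hD := hA.D 0 _ _ hx hy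
    rw [hxy, zero_mul, zero_add] at hD
    simp only [Nat.testBit_and, Nat.testBit_xor, Bool.and_eq_true] at hj
    have := hj.2
    rw [hD] at this
    intro hc
    simp [← hc] at this

theorem PatchData.agrees_spec (hP : IsPatch nb A.n A.w ι) (hA : A.Valid δ)
    (hS : S.Valid nb s A.n A.w ι i) {d : Dir} {p : ℕ} (h : A.agrees S d p = true) {x y : ℕ}
    (hx : x < A.n) (hy : y < A.n) :
    if p.testBit (x + A.n * y) = true then caApp nb s i (ι x y) d < 0
      else 0 < caApp nb s i (ι x y) d := by
  simp only [PatchData.agrees, Bool.and_eq_true, Nat.beq_eq, natLand_eq, natLor_eq, hA.full] at h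
  have h1 := congrArg (fun m => m.testBit (x + A.n * y)) h.1
  have h2 := congrArg (fun m => m.testBit (x + A.n * y)) h.2
  simp only [Nat.testBit_and, Nat.testBit_or, Nat.testBit_two_pow_sub_one, patchIndex_lt hx hy,
    decide_true, Bool.and_true] at h1 h2
  split_ifs with hp
  · exact PatchData.neg_spec hP hA hS hx hy (by simpa [hp] using h1)
  · exact PatchData.pos_spec hP hA hS hx hy (by simpa [hp] using h2)

end

/-! ### Short cycles -/

/-- The edges of a plaquette. -/
def plaquette (x y : ℕ) : List (Bool × ℕ × ℕ) :=
  [(false, x, y), (false, x, y + 1), (true, x, y), (true, x + 1, y)]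

/-- The boundary of two plaquettes side by side. -/
def dominoH (x y : ℕ) : List (Bool × ℕ × ℕ) :=
  [(false, x, y), (false, x + 1, y), (false, x, y + 1), (false, x + 1, y + 1), (true, x, y),
    (true, x + 2, y)]

/-- The boundary of two plaquettes on top of each other. -/
def dominoV (x y : ℕ) : List (Bool × ℕ × ℕ) :=
  [(true, x, y), (true, x, y + 1), (true, x + 1, y), (true, x + 1, y + 1), (false, x, y),
    (false, x, y + 2)]

/-- The cycles of length 4 and 6 through an edge. -/
def cyclesThrough (q : Bool × ℕ × ℕ) : List (List (Bool × ℕ × ℕ)) :=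
  bif q.1 then
    [plaquette q.2.1 q.2.2, plaquette (q.2.1 - 1) q.2.2, dominoV q.2.1 q.2.2,
      dominoV q.2.1 (q.2.2 - 1), dominoV (q.2.1 - 1) q.2.2, dominoV (q.2.1 - 1) (q.2.2 - 1),
      dominoH q.2.1 q.2.2, dominoH (q.2.1 - 2) q.2.2]
  else
    [plaquette q.2.1 q.2.2, plaquette q.2.1 (q.2.2 - 1), dominoH q.2.1 q.2.2,
      dominoH (q.2.1 - 1) q.2.2, dominoH q.2.1 (q.2.2 - 1), dominoH (q.2.1 - 1) (q.2.2 - 1),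
      dominoV q.2.1 q.2.2, dominoV q.2.1 (q.2.2 - 2)]

/-- A list of edges that has the shape of a cycle of length 4 or 6. -/
def IsShortCycle (c : List (Bool × ℕ × ℕ)) : Prop :=
  ∃ x y, c = plaquette x y ∨ c = dominoH x y ∨ c = dominoV x y

theorem isShortCycle_of_mem {q : Bool × ℕ × ℕ} {c : List (Bool × ℕ × ℕ)}
    (h : c ∈ cyclesThrough q) : IsShortCycle c := by
  rcases q with ⟨_ | _, x, y⟩ <;>
    simp only [cyclesThrough, cond_true, cond_false, List.mem_cons, List.not_mem_nil,
      or_false] at h <;>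
    rcases h with rfl | rfl | rfl | rfl | rfl | rfl | rfl | rfl <;>
    first
      | exact ⟨_, _, Or.inl rfl⟩
      | exact ⟨_, _, Or.inr (Or.inl rfl)⟩
      | exact ⟨_, _, Or.inr (Or.inr rfl)⟩

section

variable {L : ℕ}

theorem nqubit_shift (b : Bool) (o : ToricVertex L) (x y : ℕ) (q : Bool × ℕ × ℕ) :
    nqubit L b (npt L b o x y) q = nqubit L b o (q.1, x + q.2.1, y + q.2.2) := by
  simp only [nqubit, npt_npt]

/-- The cycle is a translate of one at the origin whose coordinates are below `9 ≤ L`, so no two of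
its edges are identified on the torus. -/
theorem IsShortCycle.nodup (hL : 9 ≤ L) {c : List (Bool × ℕ × ℕ)} (hc : IsShortCycle c) (b : Bool)
    (o : ToricVertex L) : (c.map (nqubit L b o)).Nodup := by
  obtain ⟨x, y, hc⟩ := hc
  have key : ∀ c₀ : List (Bool × ℕ × ℕ), c₀.Nodup → (∀ q ∈ c₀, q.2.1 < 9 ∧ q.2.2 < 9) →
      c = c₀.map (fun q => (q.1, x + q.2.1, y + q.2.2)) → (c.map (nqubit L b o)).Nodup := by
    rintro c₀ h1 h2 rfl
    rw [List.map_map]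
    have : (nqubit L b o ∘ fun q : Bool × ℕ × ℕ => (q.1, x + q.2.1, y + q.2.2)) =
        nqubit L b (npt L b o x y) := by
      ext1 q; exact (nqubit_shift b o x y q).symm
    rw [this]
    refine (List.nodup_map_iff_inj_on h1).2 fun q hq q' hq' h => ?_
    have := h2 q hq
    have := h2 q' hq'
    exact nqubit_inj b _ (by omega) (by omega) (by omega) (by omega) h
  rcases hc with rfl | rfl | rfl
  · exact key (plaquette 0 0) (by decide) (by decide) rfl
  · exact key (dominoH 0 0) (by decide) (by decide) rfl
  · exact key (dominoV 0 0) (by decide) (by decide) rfl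

variable [NeZero L]

/-- Every vertex on the cycle is an end of exactly two of its edges, and `2 = 0`. -/
theorem IsShortCycle.mulVec_chain {c : List (Bool × ℕ × ℕ)} (hc : IsShortCycle c) (b : Bool)
    (o : ToricVertex L) : toricHZ L *ᵥ chain L b o c = 0 := by
  have h2 : (2 : ToricVertex L → ZMod 2) = 0 := by ext v; exact (by decide : (2 : ZMod 2) = 0)
  obtain ⟨x, y, rfl | rfl | rfl⟩ := hc <;>
    simp only [plaquette, dominoH, dominoV, toricHZ_mulVec_chain_cons, edgeEnd, cond_true,
      cond_false, chain_nil, Matrix.mulVec_zero, add_zero]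
  · linear_combination ((Pi.single (npt L b o x y) 1 + Pi.single (npt L b o (x + 1) y) 1 +
      Pi.single (npt L b o x (y + 1)) 1 + Pi.single (npt L b o (x + 1) (y + 1)) 1 :
        ToricVertex L → ZMod 2)) * h2
  · linear_combination ((Pi.single (npt L b o x y) 1 + Pi.single (npt L b o (x + 1) y) 1 +
      Pi.single (npt L b o x (y + 1)) 1 + Pi.single (npt L b o (x + 1) (y + 1)) 1 +
      Pi.single (npt L b o (x + 2) y) 1 + Pi.single (npt L b o (x + 2) (y + 1)) 1 :
        ToricVertex L → ZMod 2)) * h2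
  · linear_combination ((Pi.single (npt L b o x y) 1 + Pi.single (npt L b o (x + 1) y) 1 +
      Pi.single (npt L b o x (y + 1)) 1 + Pi.single (npt L b o (x + 1) (y + 1)) 1 +
      Pi.single (npt L b o x (y + 2)) 1 + Pi.single (npt L b o (x + 1) (y + 2)) 1 :
        ToricVertex L → ZMod 2)) * h2

theorem IsShortCycle.isDegenerate (hL : 9 ≤ L) {c : List (Bool × ℕ × ℕ)} (hc : IsShortCycle c)
    (b : Bool) (o : ToricVertex L) {e : ToricQubit L → ZMod 2}
    (h : c.length ≤ 2 * c.countP fun q => decide (e (nqubit L b o q) ≠ 0)) :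
    IsDegenerate (toricHZ L) e := by
  have hnd := hc.nodup hL b o
  refine isDegenerate_of_cycle (c.map (nqubit L b o)).toFinset ?_ ?_ ?_
  · obtain ⟨x, y, rfl | rfl | rfl⟩ := hc <;> exact ⟨_, List.mem_toFinset.2 List.mem_cons_self⟩
  · rw [← hc.mulVec_chain b o]
    congr 1
    ext q
    rw [chain_apply b o hnd]
    simp only [List.mem_toFinset]
  · have hf : (c.map (nqubit L b o)).toFinset.filter (fun q => e q ≠ 0) =
        ((c.map (nqubit L b o)).filter fun q => decide (e q ≠ 0)).toFinset := by
      ext q; simp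
    rw [hf, List.toFinset_card_of_nodup hnd, List.length_map,
      List.toFinset_card_of_nodup (hnd.filter _), ← List.countP_eq_length_filter, List.countP_map]
    exact h

end

/-! ### Patches of the torus -/

section

variable {L : ℕ}

theorem isPatch_npt {n : ℕ} (w : Bool) (hn : 0 < n) (hnL : n ≤ L) (hw : w = true → n = L)
    (b : Bool) (o : ToricVertex L) : IsPatch (tnb L b) n w (npt L b o) where
  pos := hn
  opp := tnb_opp b
  right x y _ _ := tnb_npt_right b o x y
  up x y _ _ := tnb_npt_up b o x y
  inj x y x' y' hx hy hx' hy' h :=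
    npt_inj b o (by omega) (by omega) (by omega) (by omega) h
  wrapRight h y _ := by
    rw [tnb_npt_right, Nat.sub_add_cancel hn, hw h]
    cases b <;> simp [npt, toricStep, Prod.ext_iff]
  wrapUp h x _ := by
    rw [tnb_npt_up, Nat.sub_add_cancel hn, hw h]
    cases b <;> simp [npt, toricStep, Prod.ext_iff]

end

/-! ### Lists of edges as bit masks, and their syndromes -/

/-- The cells in an odd number of edges of a list. -/
noncomputable def oddBits (n : ℕ) (P : List (Bool × ℕ × ℕ)) : ℕ :=
  List.rec 0 (fun q _ m => Nat.xor (Nat.pow 2 (q.2.1 + n * q.2.2))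
    (Nat.xor (Nat.pow 2 ((edgeEnd q).1 + n * (edgeEnd q).2)) m)) P

theorem oddBits_cons (n : ℕ) (q : Bool × ℕ × ℕ) (P : List (Bool × ℕ × ℕ)) :
    oddBits n (q :: P) = 2 ^ (q.2.1 + n * q.2.2) ^^^
      (2 ^ ((edgeEnd q).1 + n * (edgeEnd q).2) ^^^ oddBits n P) := rfl

/-- The cells of the edges of a list in the direction of an axis. -/
noncomputable def axisBits (n : ℕ) (a : Bool) (P : List (Bool × ℕ × ℕ)) : ℕ :=
  List.rec 0 (fun q _ m => bif xor a q.1 then m else Nat.lor (Nat.pow 2 (q.2.1 + n * q.2.2)) m) P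

theorem axisBits_cons (n : ℕ) (a : Bool) (q : Bool × ℕ × ℕ) (P : List (Bool × ℕ × ℕ)) :
    axisBits n a (q :: P) =
      bif xor a q.1 then axisBits n a P else 2 ^ (q.2.1 + n * q.2.2) ||| axisBits n a P := rfl

/-- All the edges of a list have their ends in the patch. -/
def InPatch (n : ℕ) (P : List (Bool × ℕ × ℕ)) : Prop := ∀ q ∈ P, q.2.1 + 1 < n ∧ q.2.2 + 1 < n

theorem patchIndex_inj {n x y x' y' : ℕ} (hx : x < n) (hx' : x' < n)
    (h : x + n * y = x' + n * y') : x = x' ∧ y = y' := by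
  have e1 := patchIndex_mod 0 y hx
  have e2 := patchIndex_mod 0 y' hx'
  rw [h] at e1
  have hx : x = x' := e1.symm.trans e2
  refine ⟨hx, ?_⟩
  subst hx
  exact Nat.eq_of_mul_eq_mul_left (by omega) (Nat.add_left_cancel h)

theorem oddBits_lt {n : ℕ} {P : List (Bool × ℕ × ℕ)} (hP : InPatch n P) :
    oddBits n P < 2 ^ (n * n) := by
  induction P with
  | nil => exact Nat.two_pow_pos _
  | cons q P ih =>
    have h1 := hP q List.mem_cons_self
    rw [oddBits_cons]
    refine Nat.xor_lt_two_pow ?_ (Nat.xor_lt_two_pow ?_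
      (ih fun q hq => hP q (List.mem_cons_of_mem _ hq)))
    · exact Nat.pow_lt_pow_right one_lt_two (patchIndex_lt (by omega) (by omega))
    · refine Nat.pow_lt_pow_right one_lt_two (patchIndex_lt ?_ ?_) <;>
        rcases q with ⟨_ | _, x, y⟩ <;> simp [edgeEnd] at h1 ⊢ <;> omega

theorem testBit_axisBits {n : ℕ} (a : Bool) {P : List (Bool × ℕ × ℕ)} (hP : InPatch n P) {x y : ℕ}
    (hx : x < n) : (axisBits n a P).testBit (x + n * y) = true ↔ (a, x, y) ∈ P := by
  induction P with
  | nil => simp [axisBits]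
  | cons q P ih =>
    have h1 := hP q List.mem_cons_self
    have ih := ih fun q hq => hP q (List.mem_cons_of_mem _ hq)
    rw [axisBits_cons, List.mem_cons]
    rcases q with ⟨a', x', y'⟩
    rcases eq_or_ne a a' with rfl | ha
    · simp only [Bool.xor_self, cond_false, Nat.testBit_or, Nat.testBit_two_pow, Bool.or_eq_true,
        decide_eq_true_eq, ih]
      refine or_congr_left ?_
      constructor
      · intro h
        obtain ⟨rfl, rfl⟩ := patchIndex_inj (by simp at h1; omega) hx h
        rfl
      · intro h
        simp only [Prod.mk.injEq] at h
        rw [h.2.1, h.2.2]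
    · have : xor a a' = true := by simpa using ha
      simp [this, ih, ha]

theorem chain_nodup {L n : ℕ} (hnL : n ≤ L) (b : Bool) (o : ToricVertex L) {P : List (Bool × ℕ × ℕ)}
    (hP : InPatch n P) (hnd : P.Nodup) : (P.map (nqubit L b o)).Nodup := by
  refine (List.nodup_map_iff_inj_on hnd).2 fun q hq q' hq' h => ?_
  have := hP q hq
  have := hP q' hq'
  exact nqubit_inj b _ (by omega) (by omega) (by omega) (by omega) h

section

variable {L : ℕ} [NeZero L] {n : ℕ}

theorem defect_mulVec_chain (hnL : n ≤ L) (b : Bool) (o : ToricVertex L)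
    {P : List (Bool × ℕ × ℕ)} (hP : InPatch n P) {x y : ℕ} (hx : x < n) (hy : y < n) :
    defect (toricHZ L *ᵥ chain L b o P) (npt L b o x y) = (oddBits n P).testBit (x + n * y) := by
  have hpt : ∀ x' y', x' < n → y' < n →
      ((Pi.single (npt L b o x' y') 1 : ToricVertex L → ZMod 2) (npt L b o x y) =
        if (2 ^ (x' + n * y')).testBit (x + n * y) then 1 else 0) := by
    intro x' y' hx' hy'
    rw [Pi.single_apply, Nat.testBit_two_pow]
    by_cases h : npt L b o x y = npt L b o x' y'
    · obtain ⟨rfl, rfl⟩ := npt_inj b o (by omega) (by omega) (by omega) (by omega) h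
      simp
    · rw [if_neg h, if_neg]
      intro h'
      obtain ⟨rfl, rfl⟩ := patchIndex_inj hx' hx (of_decide_eq_true h')
      exact h rfl
  induction P with
  | nil => simp [chain_nil, defect, oddBits]
  | cons q P ih =>
    have h1 := hP q List.mem_cons_self
    have ih := ih fun q hq => hP q (List.mem_cons_of_mem _ hq)
    have h2 : (edgeEnd q).1 < n ∧ (edgeEnd q).2 < n := by
      rcases q with ⟨_ | _, x, y⟩ <;> simp [edgeEnd] at h1 ⊢ <;> omega
    rw [toricHZ_mulVec_chain_cons, oddBits_cons, Nat.testBit_xor, Nat.testBit_xor, ← ih]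
    simp only [defect, Pi.add_apply, hpt _ _ (Nat.lt_of_succ_lt h1.1) (Nat.lt_of_succ_lt h1.2),
      hpt _ _ h2.1 h2.2]
    generalize (2 ^ (q.2.1 + n * q.2.2)).testBit (x + n * y) = u
    generalize (2 ^ ((edgeEnd q).1 + n * (edgeEnd q).2)).testBit (x + n * y) = v
    generalize (toricHZ L *ᵥ chain L b o P) (npt L b o x y) = z
    revert u v z
    decide

theorem defect_mulVec_chain_outside (b : Bool) (o : ToricVertex L)
    {P : List (Bool × ℕ × ℕ)} (hP : InPatch n P) {v : ToricVertex L}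
    (hv : ∀ x y, x < n → y < n → v ≠ npt L b o x y) :
    defect (toricHZ L *ᵥ chain L b o P) v = false := by
  have : (toricHZ L *ᵥ chain L b o P) v = 0 := by
    induction P with
    | nil => simp [chain_nil]
    | cons q P ih =>
      have h1 := hP q List.mem_cons_self
      have h2 : (edgeEnd q).1 < n ∧ (edgeEnd q).2 < n := by
        rcases q with ⟨_ | _, x, y⟩ <;> simp [edgeEnd] at h1 ⊢ <;> omega
      rw [toricHZ_mulVec_chain_cons, Pi.add_apply, Pi.add_apply,
        ih fun q hq => hP q (List.mem_cons_of_mem _ hq), Pi.single_apply, Pi.single_apply,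
        if_neg (hv _ _ (by omega) (by omega)), if_neg (hv _ _ h2.1 h2.2)]
      simp
  simp [defect, this]

end

/-! ### The computation -/

namespace PatchData

/-- The data of a computation on an `n × n` patch with the syndrome of a list of edges. -/
noncomputable def ofEdges (n : ℕ) (w : Bool) (P : List (Bool × ℕ × ℕ)) : PatchData where
  n := n
  N := n * n
  full := 2 ^ (n * n) - 1
  w := w
  sides d := cellMask n (side n d)
  cosides d := cellMask n fun x y => !side n d x y
  D := repeatBits (n * n) (oddBits n P) 16
  E := repeatBits (n * n) (oddBits n P) 16 ^^^ (2 ^ (16 * (n * n)) - 1)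

/-- The function of a direction with the given values. -/
def dirCases {α : Type*} (a00 a01 a10 a11 : α) (d : Dir) : α :=
  bif d.1 then (bif d.2 then a11 else a10) else (bif d.2 then a01 else a00)

theorem dirCases_eq {α : Type*} (f : Dir → α) :
    dirCases (f (false, false)) (f (false, true)) (f (true, false)) (f (true, true)) = f := by
  ext1 ⟨_ | _, _ | _⟩ <;> rfl

/-- `f s c`, where `s` gives the masks of the sides of the patch, and `c` those of their
complements. -/
noncomputable def withSides {α : Type*} (n : ℕ) (f : (Dir → ℕ) → (Dir → ℕ) → α) : α :=
  withNat (cellMask n (side n (false, false))) fun s00 =>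
  withNat (cellMask n (side n (false, true))) fun s01 =>
  withNat (cellMask n (side n (true, false))) fun s10 =>
  withNat (cellMask n (side n (true, true))) fun s11 =>
  withNat (cellMask n fun x y => !side n (false, false) x y) fun c00 =>
  withNat (cellMask n fun x y => !side n (false, true) x y) fun c01 =>
  withNat (cellMask n fun x y => !side n (true, false) x y) fun c10 =>
  withNat (cellMask n fun x y => !side n (true, true) x y) fun c11 =>
  f (dirCases s00 s01 s10 s11) (dirCases c00 c01 c10 c11)

theorem withSides_eq {α : Type*} (n : ℕ) (f : (Dir → ℕ) → (Dir → ℕ) → α) :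
    withSides n f = f (fun d => cellMask n (side n d))
      (fun d => cellMask n fun x y => !side n d x y) := by
  simp only [withSides, withNat_eq]
  rw [dirCases_eq fun d => cellMask n (side n d),
    dirCases_eq fun d => cellMask n fun x y => !side n d x y]

/-- `f A`, where `A` is the data of `ofEdges`, with masks `s` and `c`. -/
noncomputable def withEdges {α : Type*} (n : ℕ) (w : Bool) (s c : Dir → ℕ)
    (P : List (Bool × ℕ × ℕ)) (f : PatchData → α) : α :=
  withNat (Nat.mul n n) fun N =>
  withNat (Nat.sub (Nat.pow 2 N) 1) fun full =>
  withNat (oddBits n P) fun m =>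
  withNat (repeatBits N m 16) fun D =>
  withNat (Nat.xor D (Nat.sub (Nat.pow 2 (Nat.mul 16 N)) 1)) fun E =>
  f ⟨n, N, full, w, s, c, D, E⟩

theorem withEdges_eq {α : Type*} (n : ℕ) (w : Bool) (P : List (Bool × ℕ × ℕ))
    (f : PatchData → α) :
    withEdges n w (fun d => cellMask n (side n d)) (fun d => cellMask n fun x y => !side n d x y)
      P f = f (ofEdges n w P) := by
  simp only [withEdges, withNat_eq]
  rfl

theorem ofEdges_valid {n : ℕ} {w : Bool} {P : List (Bool × ℕ × ℕ)} (hP : InPatch n P) :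
    (ofEdges n w P).Valid fun x y => (oddBits n P).testBit (x + n * y) where
  N := rfl
  full := rfl
  sides _ := rfl
  cosides _ := rfl
  D t _ _ hx hy := testBit_repeatBits (oddBits_lt hP) 16 t (patchIndex_lt hx hy)
  E := rfl

/-- `f S`, where `S` is the state at the beginning. -/
noncomputable def withInit {α : Type*} (n : ℕ) (f : PatchState → α) : α :=
  withBounds ⟨2 ^ (10 * (n * n)) - 1, 2 ^ (8 * (n * n)) - 1⟩ fun B => f ⟨B, B, B, B, 10⟩

theorem withInit_eq {α : Type*} (n : ℕ) (f : PatchState → α) :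
    withInit n f = f (PatchState.init n) := by
  simp only [withInit, withBounds_eq]; rfl

/-- Whether one of the first `k` errors estimated after the state `S` certainly is the error with
masks `p` and `q` on the two axes, those before violating the syndrome. -/
noncomputable def decodes (A : PatchData) (p q : ℕ) (k : ℕ) (S : PatchState) : Bool :=
  Nat.rec (motive := fun _ => PatchState → Bool) (fun _ => false)
    (fun _ r S => A.withStep S fun S => Nat.ble 10 S.M &&
      ((A.agrees S (false, true) p && A.agrees S (true, true) q) || (A.conflict S && r S))) k S

theorem decodes_succ (A : PatchData) (p q k : ℕ) (S : PatchState) :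
    A.decodes p q (k + 1) S = (Nat.ble 10 (A.step S).M &&
      ((A.agrees (A.step S) (false, true) p && A.agrees (A.step S) (true, true) q) ||
        (A.conflict (A.step S) && A.decodes p q k (A.step S)))) := by
  rw [← withStep_eq A S fun S => (Nat.ble 10 S.M && ((A.agrees S (false, true) p &&
    A.agrees S (true, true) q) || (A.conflict S && A.decodes p q k S)))]
  rfl

/-- Whether the first `k` errors estimated after the state `S` certainly violate the syndrome,
and the state after that satisfies `f`. -/
noncomputable def conflicts (A : PatchData) (f : PatchState → Bool) (k : ℕ) (S : PatchState) :
    Bool :=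
  Nat.rec (motive := fun _ => PatchState → Bool) f
    (fun _ r S => A.withStep S fun S => Nat.ble 10 S.M && A.conflict S && r S) k S

theorem conflicts_succ (A : PatchData) (f : PatchState → Bool) (k : ℕ) (S : PatchState) :
    A.conflicts f (k + 1) S = (Nat.ble 10 (A.step S).M && A.conflict (A.step S) &&
      A.conflicts f k (A.step S)) := by
  rw [← withStep_eq A S fun S => (Nat.ble 10 S.M && A.conflict S && A.conflicts f k S)]
  rfl

/-- Whether the bounds `B` follow from the bounds `C`. -/
def impliedBy (B C : Bounds) : Bool :=
  Nat.beq (Nat.land B.l C.l) B.l && Nat.beq (Nat.land B.n C.n) B.n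

/-- Whether the bounds of the state `S` follow from those of the state `T`. -/
def stateImpliedBy (S T : PatchState) : Bool :=
  impliedBy S.b00 T.b00 && impliedBy S.b01 T.b01 && impliedBy S.b10 T.b10 &&
    impliedBy S.b11 T.b11 && Nat.ble 10 S.M && Nat.ble S.M T.M

/-- Whether the errors estimated on the syndrome of `P` certainly violate the syndrome for `k`
iterations, and then again and again for `k'` iterations. -/
noncomputable def neverStops (n : ℕ) (w : Bool) (P : List (Bool × ℕ × ℕ)) (k k' : ℕ) : Bool :=
  withSides n fun s c => withEdges n w s c P fun A => withInit n fun S₀ =>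
    A.conflict S₀ && A.conflicts (fun S => A.conflicts (fun T => stateImpliedBy S T) k' S) k S₀

/-- Whether the min-sum decoder certainly finds `P` on a 9 × 9 patch in at most 5 iterations. -/
noncomputable def finds (s c : Dir → ℕ) (P : List (Bool × ℕ × ℕ)) : Bool :=
  withEdges 9 false s c P fun A => withInit 9 fun S₀ =>
    withNat (axisBits 9 false P) fun p => withNat (axisBits 9 true P) fun q =>
      A.conflict S₀ && A.decodes p q 5 S₀

end PatchData

/-! ### Correctness of the computation -/

/-- At some vertex, the error estimated at iteration `i` violates the syndrome `s`, without any
ties. -/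
def Violates {V : Type*} (nb : V → Dir → V) (s : V → Bool) (i : ℕ) : Prop :=
  ∃ v, ∃ f : Dir → Bool, (∀ d, if f d = true then caApp nb s i v d < 0 else 0 < caApp nb s i v d) ∧
    (xor (f (false, false)) (xor (f (false, true)) (xor (f (true, false)) (f (true, true))))) ≠ s v

section

variable {V : Type*} {nb : V → Dir → V} {s : V → Bool} {A : PatchData} {ι : ℕ → ℕ → V}
  {S : PatchState} {i : ℕ} {δ : ℕ → ℕ → Bool}

theorem PatchData.violates_of_conflict (hP : IsPatch nb A.n A.w ι) (hA : A.Valid δ)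
    (hδ : ∀ x y, x < A.n → y < A.n → s (ι x y) = δ x y)
    (hS : S.Valid nb s A.n A.w ι i) (h : A.conflict S = true) : Violates nb s i := by
  obtain ⟨x, y, hx, hy, f, hf, hne⟩ := PatchData.conflict_spec hP hA hS h
  exact ⟨ι x y, f, hf, by rwa [hδ x y hx hy]⟩

theorem PatchData.conflicts_spec (hP : IsPatch nb A.n A.w ι) (hA : A.Valid δ)
    (hδ : ∀ x y, x < A.n → y < A.n → s (ι x y) = δ x y)
    (hout : ∀ v, (∀ x y, x < A.n → y < A.n → v ≠ ι x y) → s v = false)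
    (hS : S.Valid nb s A.n A.w ι i) {f : PatchState → Bool} {k : ℕ}
    (h : A.conflicts f k S = true) :
    (∀ j, i < j → j ≤ i + k → Violates nb s j) ∧
      ∃ T : PatchState, T.Valid nb s A.n A.w ι (i + k) ∧ f T = true := by
  induction k generalizing S i with
  | zero => exact ⟨fun j h1 h2 => by omega, S, hS, h⟩
  | succ k ih =>
    rw [PatchData.conflicts_succ] at h
    simp only [Bool.and_eq_true] at h
    obtain ⟨⟨hM, hc⟩, h⟩ := h
    have hS' := PatchData.step_valid hP hA hδ hout hS (Nat.le_of_ble_eq_true hM)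
    obtain ⟨h1, h2⟩ := ih hS' h
    refine ⟨fun j hj1 hj2 => ?_, ?_⟩
    · rcases (Nat.succ_le_of_lt hj1).eq_or_lt with rfl | hj
      · exact PatchData.violates_of_conflict hP hA hδ hS' hc
      · exact h1 j hj (by omega)
    · rwa [add_assoc, add_comm 1 k] at h2

theorem Bounds.Valid.of_impliedBy {n : ℕ} {B C : Bounds} {g : ℕ → ℕ → ℤ} (hC : C.Valid n g)
    (h : PatchData.impliedBy B C = true) : B.Valid n g := by
  simp only [PatchData.impliedBy, Bool.and_eq_true, Nat.beq_eq, natLand_eq] at h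
  constructor <;> intro t x y hx hy ht
  · rw [← h.1, Nat.testBit_and, Bool.and_eq_true] at ht
    exact hC.1 t x y hx hy ht.2
  · rw [← h.2, Nat.testBit_and, Bool.and_eq_true] at ht
    exact hC.2 t x y hx hy ht.2

/-- Fewer bits and a smaller `M` assert less, so an earlier state can be valid again at a later
iteration. This closes the loop in the proof that the decoder never stops. -/
theorem PatchState.Valid.of_impliedBy {n : ℕ} {w : Bool} {T : PatchState}
    (hT : T.Valid nb s n w ι i) (h : PatchData.stateImpliedBy S T = true) :
    S.Valid nb s n w ι i := by
  simp only [PatchData.stateImpliedBy, Bool.and_eq_true] at h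
  obtain ⟨⟨⟨⟨⟨h00, h01⟩, h10⟩, h11⟩, h1⟩, h2⟩ := h
  have h1 := Nat.le_of_ble_eq_true h1
  have h2 := Nat.le_of_ble_eq_true h2
  refine ⟨fun d => ?_, h1, fun hw v hv d => ?_, fun hw d x y hx hy hs => ?_⟩
  · have := hT.out d
    rcases d with ⟨_ | _, _ | _⟩
    exacts [this.of_impliedBy h00, this.of_impliedBy h01, this.of_impliedBy h10,
      this.of_impliedBy h11]
  · have := hT.outside hw v hv d
    omega
  · have := hT.exit hw d x y hx hy hs
    omega

end

/-! ### Consequences of the computation for the decoder -/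

section

variable {L : ℕ} [NeZero L]

theorem msEstimate_tedge (hL : 3 ≤ L) (b : Bool)
    (tie : (ToricVertex L → ZMod 2) → ℕ → ToricQubit L → ZMod 2) (s : ToricVertex L → ZMod 2)
    (i : ℕ) (v : ToricVertex L) (d : Dir) (c : Bool)
    (h : if c = true then caApp (tnb L b) (defect s) i v d < 0
      else 0 < caApp (tnb L b) (defect s) i v d) :
    msEstimate (toricHZ L) tie s i (tedge L b v d) = if c = true then 1 else 0 := by
  rw [msEstimate, msApp_tedge hL]
  cases c
  · simp only [Bool.false_eq_true, if_false] at h ⊢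
    rw [if_neg (by omega), if_pos h]
  · simp only [if_true] at h ⊢
    rw [if_pos h]

/-- The estimates at the four edges of the vertex have strict signs, so no tie-breaking rule can
repair their parity. -/
theorem Violates.mulVec_msEstimate_ne (hL : 3 ≤ L) {b : Bool} {s : ToricVertex L → ZMod 2} {i : ℕ}
    (h : Violates (tnb L b) (defect s) i)
    (tie : (ToricVertex L → ZMod 2) → ℕ → ToricQubit L → ZMod 2) :
    toricHZ L *ᵥ msEstimate (toricHZ L) tie s i ≠ s := by
  obtain ⟨v, f, hf, hne⟩ := h
  intro h
  refine hne ?_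
  have h1 := congrFun h v
  rw [toricHZ_mulVec hL b,
    Finset.sum_congr rfl fun d _ => msEstimate_tedge hL b tie s i v d (f d) (hf d)] at h1
  simp only [Fintype.sum_prod_type, Fintype.sum_bool] at h1
  rw [defect, ← h1]
  generalize f (false, false) = a
  generalize f (false, true) = b
  generalize f (true, false) = c
  generalize f (true, true) = d
  revert a b c d
  decide

/-- Iteration 0 and the next `k` are refuted directly, and every later one lies in a block of `k'`
iterations that starts from the same valid bounds. -/
theorem PatchData.mulVec_msEstimate_ne_of_neverStops {n : ℕ} {w : Bool}
    {P : List (Bool × ℕ × ℕ)} {k k' : ℕ} (h : PatchData.neverStops n w P k k' = true)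
    (hL : 3 ≤ L) (hn : 0 < n) (hnL : n ≤ L) (hw : w = true → n = L) (hP : InPatch n P)
    (hk' : 0 < k') (b : Bool) (o : ToricVertex L)
    (tie : (ToricVertex L → ZMod 2) → ℕ → ToricQubit L → ZMod 2) (i : ℕ) :
    toricHZ L *ᵥ msEstimate (toricHZ L) tie (toricHZ L *ᵥ chain L b o P) i ≠
      toricHZ L *ᵥ chain L b o P := by
  have hpatch : IsPatch (tnb L b) (PatchData.ofEdges n w P).n (PatchData.ofEdges n w P).w
    (npt L b o) := isPatch_npt w hn hnL hw b o
  have hA := PatchData.ofEdges_valid (w := w) hP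
  have hδ : ∀ x y, x < n → y < n → defect (toricHZ L *ᵥ chain L b o P) (npt L b o x y) =
      (oddBits n P).testBit (x + n * y) := fun x y hx hy => defect_mulVec_chain hnL b o hP hx hy
  have hout : ∀ v, (∀ x y, x < n → y < n → v ≠ npt L b o x y) →
      defect (toricHZ L *ᵥ chain L b o P) v = false :=
    fun v hv => defect_mulVec_chain_outside b o hP hv
  rw [PatchData.neverStops, PatchData.withSides_eq, PatchData.withEdges_eq,
    PatchData.withInit_eq, Bool.and_eq_true] at h
  have hinit := PatchState.init_valid (nb := tnb L b) (s := defect (toricHZ L *ᵥ chain L b o P))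
    (ι := npt L b o) n w
  obtain ⟨h1, S, hS, h2⟩ := PatchData.conflicts_spec hpatch hA hδ hout hinit h.2
  have key : ∀ m i, k + m * k' < i → i ≤ k + (m + 1) * k' →
      Violates (tnb L b) (defect (toricHZ L *ᵥ chain L b o P)) i := by
    -- The messages need not be periodic: only the bounds recorded in `S` hold again after each `k'`
    -- iterations.
    have hSm : ∀ m, S.Valid (tnb L b) (defect (toricHZ L *ᵥ chain L b o P)) n w (npt L b o)
        (k + m * k') := by
      intro m
      induction m with
      | zero => rw [zero_mul, add_zero, ← zero_add k]; exact hS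
      | succ m ih =>
        obtain ⟨-, T, hT, h3⟩ := PatchData.conflicts_spec hpatch hA hδ hout ih h2
        rw [Nat.succ_mul, ← add_assoc]
        exact PatchState.Valid.of_impliedBy hT h3
    intro m i hi hi'
    refine (PatchData.conflicts_spec hpatch hA hδ hout (hSm m) h2).1 i hi ?_
    rwa [Nat.succ_mul, ← add_assoc] at hi'
  refine Violates.mulVec_msEstimate_ne hL (b := b) ?_ tie
  rcases Nat.eq_zero_or_pos i with rfl | hi
  · exact PatchData.violates_of_conflict hpatch hA hδ hinit h.1
  rcases le_or_gt i k with hik | hik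
  · exact h1 i hi (by omega)
  -- The blocks begin at iteration `k + 1`, hence the offset in the division.
  · have h4 := Nat.div_add_mod (i - k - 1) k'
    have h5 := Nat.mod_lt (i - k - 1) hk'
    refine key ((i - k - 1) / k') i ?_ ?_
    · rw [mul_comm]; omega
    · rw [Nat.succ_mul, mul_comm]; omega

theorem msRecovers_of_first {C Q : Type*} [Fintype C] [DecidableEq C] [Fintype Q] [DecidableEq Q]
    {H : Matrix C Q (ZMod 2)} {tie : (C → ZMod 2) → ℕ → Q → ZMod 2} {e : Q → ZMod 2} (k : ℕ)
    (hk : msEstimate H tie (H *ᵥ e) k = e)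
    (h : ∀ i < k, H *ᵥ msEstimate H tie (H *ᵥ e) i = H *ᵥ e → msEstimate H tie (H *ᵥ e) i = e) :
    MSRecovers H tie e := by
  classical
  have hex : ∃ k, H *ᵥ msEstimate H tie (H *ᵥ e) k = H *ᵥ e := ⟨k, by rw [hk]⟩
  refine ⟨Nat.find hex, ⟨Nat.find_spec hex, fun i hi => Nat.find_min' hex hi⟩, ?_⟩
  rcases (Nat.find_min' hex (by rw [hk] : H *ᵥ msEstimate H tie (H *ᵥ e) k = H *ᵥ e)).eq_or_lt with
    h1 | h1
  · rw [h1, hk]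
  · exact h _ h1 (Nat.find_spec hex)

/-- Inside the patch the masks fix the sign of every a posteriori value. Outside, both messages on
an edge are positive, so the estimate is 0 there as it should be. -/
theorem PatchData.decodes_spec {n : ℕ} {P : List (Bool × ℕ × ℕ)} (hL : 3 ≤ L) (hn : 0 < n)
    (hnL : n ≤ L) (hP : InPatch n P) (hnd : P.Nodup) (b : Bool) (o : ToricVertex L)
    (tie : (ToricVertex L → ZMod 2) → ℕ → ToricQubit L → ZMod 2) {k : ℕ} {S : PatchState} {i : ℕ}
    (hS : S.Valid (tnb L b) (defect (toricHZ L *ᵥ chain L b o P)) n false (npt L b o) i)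
    (h : (PatchData.ofEdges n false P).decodes (axisBits n false P) (axisBits n true P) k S =
      true) :
    ∃ j, i < j ∧ msEstimate (toricHZ L) tie (toricHZ L *ᵥ chain L b o P) j = chain L b o P ∧
      ∀ j', i < j' → j' < j → toricHZ L *ᵥ msEstimate (toricHZ L) tie
        (toricHZ L *ᵥ chain L b o P) j' ≠ toricHZ L *ᵥ chain L b o P := by
  have hpatch : IsPatch (tnb L b) (PatchData.ofEdges n false P).n (PatchData.ofEdges n false P).w
    (npt L b o) := isPatch_npt false hn hnL (by simp) b o
  have hA := PatchData.ofEdges_valid (w := false) hP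
  have hδ : ∀ x y, x < n → y < n → defect (toricHZ L *ᵥ chain L b o P) (npt L b o x y) =
      (oddBits n P).testBit (x + n * y) := fun x y hx hy => defect_mulVec_chain hnL b o hP hx hy
  have hout : ∀ v, (∀ x y, x < n → y < n → v ≠ npt L b o x y) →
      defect (toricHZ L *ᵥ chain L b o P) v = false :=
    fun v hv => defect_mulVec_chain_outside b o hP hv
  induction k generalizing S i with
  | zero => exact absurd h (by simp [PatchData.decodes])
  | succ k ih =>
    rw [PatchData.decodes_succ] at h
    simp only [Bool.and_eq_true, Bool.or_eq_true] at h
    obtain ⟨hM, h⟩ := h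
    have hM := Nat.le_of_ble_eq_true hM
    have hS' := PatchData.step_valid hpatch hA hδ hout hS hM
    rcases h with ⟨h1, h2⟩ | ⟨h1, h2⟩
    · refine ⟨i + 1, Nat.lt_succ_self i, ?_, fun j' _ _ => by omega⟩
      have happ : ∀ (a : Bool) (x y : ℕ), x < n → y < n →
          if decide ((a, x, y) ∈ P) = true then caApp (tnb L b)
            (defect (toricHZ L *ᵥ chain L b o P)) (i + 1) (npt L b o x y) (a, true) < 0
          else 0 < caApp (tnb L b)
            (defect (toricHZ L *ᵥ chain L b o P)) (i + 1) (npt L b o x y) (a, true) := by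
        intro a x y hx hy
        have h3 : (PatchData.ofEdges n false P).agrees ((PatchData.ofEdges n false P).step S)
            (a, true) (axisBits n a P) = true := by cases a <;> assumption
        have h4 := PatchData.agrees_spec hpatch hA hS' h3 hx hy
        have h5 := testBit_axisBits a hP (y := y) hx
        simp only [decide_eq_true_eq, ← h5]
        exact h4
      ext q
      rw [chain_apply b o (chain_nodup hnL b o hP hnd)]
      -- The edge is read off the masks at the vertex that carries its coordinates; the cases are
      -- whether this vertex is in the patch.
      by_cases hq : ∃ x y, x < n ∧ y < n ∧ q.2 = npt L b o x y
      · obtain ⟨x, y, hx, hy, hq⟩ := hq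
        have hq' : q = nqubit L b o (xor b q.1, x, y) := by
          rw [nqubit, ← hq]; simp
        have h3 := msEstimate_tedge hL b tie _ _ _ _ _ (happ (xor b q.1) x y hx hy)
        rw [tedge_npt, ← hq'] at h3
        rw [h3]
        have h4 : q ∈ P.map (nqubit L b o) ↔ (xor b q.1, x, y) ∈ P := by
          rw [List.mem_map]
          constructor
          · rintro ⟨q', hq'', h⟩
            have := hP q' hq''
            rw [hq'] at h
            rwa [← nqubit_inj b o (by omega) (by omega) (by simp; omega) (by simp; omega) h]
          · exact fun h => ⟨_, h, hq'.symm⟩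
        simp only [decide_eq_true_eq, h4]
      · push Not at hq
        have h3 : q = tedge L b q.2 (xor b q.1, true) := by simp [tedge]
        have h4 : 0 < caApp (tnb L b) (defect (toricHZ L *ᵥ chain L b o P)) (i + 1) q.2
            (xor b q.1, true) := by
          -- Two messages of at least `M - 9 ≥ 1` give an a posteriori value of at least 1.
          have h5 := hS'.outside rfl q.2 hq (xor b q.1, true)
          have h6 : (((PatchData.ofEdges n false P).step S).M : ℤ) - 9 ≤
              caMsg (tnb L b) (defect (toricHZ L *ᵥ chain L b o P)) (i + 1)
                (tnb L b q.2 (xor b q.1, true)) (Dir.opp (xor b q.1, true)) := by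
            by_cases hr : ∃ x y, x < n ∧ y < n ∧ tnb L b q.2 (xor b q.1, true) = npt L b o x y
            · obtain ⟨x, y, hx, hy, hr⟩ := hr
              rw [hr]
              refine hS'.exit rfl _ _ _ hx hy ?_
              by_contra hs
              rw [Bool.not_eq_true] at hs
              have h1 := hpatch.next hx hy hs
              rw [← hr, hpatch.opp] at h1
              have h2 := cellNext_lt hx hy hs
              exact hq _ _ h2.1 h2.2 h1
            · push Not at hr
              exact hS'.outside rfl _ (fun x' y' hx' hy' => hr x' y' hx' hy') _
          simp only [caApp]
          omega
        have h5 := msEstimate_tedge hL b tie _ _ _ _ false (by simpa using h4)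
        rw [← h3] at h5
        rw [h5, if_neg (by simp), if_neg]
        rw [List.mem_map]
        rintro ⟨q', hq', rfl⟩
        have := hP q' hq'
        exact hq _ _ (by omega) (by omega) rfl
    · obtain ⟨j, hj1, hj2, hj3⟩ := ih hS' h2
      refine ⟨j, by omega, hj2, fun j' h3 h4 => ?_⟩
      rcases (Nat.succ_le_of_lt h3).eq_or_lt with rfl | h5
      · exact (PatchData.violates_of_conflict hpatch hA hδ hS' h1).mulVec_msEstimate_ne hL tie
      · exact hj3 j' h5 h4

theorem PatchData.msRecovers_of_finds {P : List (Bool × ℕ × ℕ)} (hL : 9 ≤ L) (hP : InPatch 9 P)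
    (hnd : P.Nodup) (b : Bool) (o : ToricVertex L)
    (tie : (ToricVertex L → ZMod 2) → ℕ → ToricQubit L → ZMod 2)
    (h : PatchData.finds (fun d => cellMask 9 (side 9 d))
      (fun d => cellMask 9 fun x y => !side 9 d x y)
      P = true) : MSRecovers (toricHZ L) tie (chain L b o P) := by
  rw [PatchData.finds, PatchData.withEdges_eq, PatchData.withInit_eq, PatchData.withNat_eq,
    PatchData.withNat_eq, Bool.and_eq_true] at h
  have hinit := PatchState.init_valid (nb := tnb L b) (s := defect (toricHZ L *ᵥ chain L b o P))
    (ι := npt L b o) 9 false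
  obtain ⟨j, hj, h1, h2⟩ := PatchData.decodes_spec (by omega) (by omega) hL hP hnd b o tie hinit h.2
  refine msRecovers_of_first j h1 fun i hi h3 => absurd h3 ?_
  rcases Nat.eq_zero_or_pos i with rfl | hi'
  · exact (PatchData.violates_of_conflict (isPatch_npt false (by omega) hL (by simp) b o)
      (PatchData.ofEdges_valid (w := false) hP)
      (fun x y hx hy => defect_mulVec_chain hL b o hP hx hy) hinit h.1).mulVec_msEstimate_ne
        (by omega) tie
  · exact h2 i hi' hi

end

/-! ### The first two iterations -/

section

variable {V : Type*} (nb : V → Dir → V) (s : V → Bool)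

/-- No neighbour of `v` other than the one in direction `d` is a defect. -/
def quiet (v : V) (d : Dir) : Bool :=
  !s (nb v (d.1, !d.2)) && (!s (nb v (!d.1, true)) && !s (nb v (!d.1, false)))

/-- Whether an edge is in error after two iterations, from the defects `u`, `v` at its ends and
the absence `nu`, `nv` of further defects next to these. -/
def secondEstimate (u nu v nv : Bool) : Bool := (u && nu && (v || !nv)) || (v && nv && (u || !nu))

theorem caMsg_one (v : V) (d : Dir) : caMsg nb s 1 v d = bif s v then 0 else 2 := by
  cases h : s v <;> simp [caMsg, minSum, h]

theorem caMsg_two (v : V) (d : Dir) :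
    caMsg nb s 2 v d = bif quiet nb s v d then bif s v then -1 else 3 else 1 := by
  rw [caMsg, caMsg_one, caMsg_one, caMsg_one, quiet]
  cases s v <;> cases s (nb v (d.1, !d.2)) <;> cases s (nb v (!d.1, true)) <;>
    cases s (nb v (!d.1, false)) <;> rfl

/-- The messages are 0 from a defect and 2 otherwise, so the value is -1, 1 or 3 for two, one or no
defects at the ends. -/
theorem caApp_one (v : V) (d : Dir) :
    if (s v && s (nb v d)) = true then caApp nb s 1 v d < 0 else 0 < caApp nb s 1 v d := by
  rw [caApp, caMsg_one, caMsg_one]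
  cases s v <;> cases s (nb v d) <;> decide

/-- The messages are -1, 1 or 3. The value `m + m' - 1` is negative exactly when one of them is -1
and the other is not 3, and it is never 0. -/
theorem caApp_two (v : V) (d : Dir) :
    if secondEstimate (s v) (quiet nb s v d) (s (nb v d)) (quiet nb s (nb v d) d.opp) = true
    then caApp nb s 2 v d < 0 else 0 < caApp nb s 2 v d := by
  rw [caApp, caMsg_two, caMsg_two]
  cases s v <;> cases s (nb v d) <;> cases quiet nb s v d <;> cases quiet nb s (nb v d) d.opp <;>
    decide

theorem violates_one (v : V) (h : xor (s v && s (nb v (false, false)))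
    (xor (s v && s (nb v (false, true))) (xor (s v && s (nb v (true, false)))
      (s v && s (nb v (true, true))))) ≠ s v) : Violates nb s 1 :=
  ⟨v, fun d => s v && s (nb v d), caApp_one nb s v, h⟩

end

/-! ### Lists of edges near an edge -/

/-- Equality of edges. -/
def edgeBeq (p q : Bool × ℕ × ℕ) : Bool :=
  Nat.beq p.2.1 q.2.1 && (Nat.beq p.2.2 q.2.2 && !xor p.1 q.1)

theorem edgeBeq_iff (p q : Bool × ℕ × ℕ) : edgeBeq p q = true ↔ p = q := by
  rcases p with ⟨a, x, y⟩
  rcases q with ⟨a', x', y'⟩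
  simp only [edgeBeq, Bool.and_eq_true, Nat.beq_eq, Prod.mk.injEq]
  cases a <;> cases a' <;> simp

/-- Membership of an edge in a list. -/
noncomputable def hasEdge (P : List (Bool × ℕ × ℕ)) (q : Bool × ℕ × ℕ) : Bool :=
  List.rec false (fun p _ r => edgeBeq p q || r) P

theorem hasEdge_iff (P : List (Bool × ℕ × ℕ)) (q : Bool × ℕ × ℕ) :
    hasEdge P q = true ↔ q ∈ P := by
  induction P with
  | nil => simp [hasEdge]
  | cons p P ih =>
    have : hasEdge (p :: P) q = (edgeBeq p q || hasEdge P q) := rfl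
    rw [this, Bool.or_eq_true, edgeBeq_iff, ih, List.mem_cons, eq_comm]

/-- The edges at a vertex (with positive coordinates). -/
def edgesAt (x y : ℕ) : List (Bool × ℕ × ℕ) :=
  [(false, x - 1, y), (false, x, y), (true, x, y - 1), (true, x, y)]

/-- Whether the vertex is in an odd number of edges of a list. -/
noncomputable def oddAt (P : List (Bool × ℕ × ℕ)) (x y : ℕ) : Bool :=
  xor (hasEdge P (false, x - 1, y)) (xor (hasEdge P (false, x, y))
    (xor (hasEdge P (true, x, y - 1)) (hasEdge P (true, x, y))))

/-- The edges at the ends of the edge `(false, 4, 4)` and at their neighbours. -/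
def nearEdges : List (Bool × ℕ × ℕ) :=
  [(false, 4, 4), (false, 3, 4), (false, 5, 4), (false, 2, 4), (false, 6, 4),
    (false, 3, 5), (false, 4, 5), (false, 5, 5), (false, 3, 3), (false, 4, 3), (false, 5, 3),
    (true, 3, 3), (true, 4, 3), (true, 5, 3), (true, 6, 3),
    (true, 3, 4), (true, 4, 4), (true, 5, 4), (true, 6, 4),
    (true, 4, 2), (true, 5, 2), (true, 4, 5), (true, 5, 5)]

/-- `k b`, with `b` evaluated first. -/
def withBool {α : Type*} (b : Bool) (k : Bool → α) : α := bif b then k true else k false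

theorem withBool_eq {α : Type*} (b : Bool) (k : Bool → α) : withBool b k = k b := by
  cases b <;> rfl

/-- Whether the edge `(false, 4, 4)` is estimated correctly after two iterations, and after one
iteration as well unless the estimate violates the syndrome at one of its ends. -/
noncomputable def locallyDecoded (P : List (Bool × ℕ × ℕ)) : Bool :=
  withBool (hasEdge P (false, 4, 4)) fun e =>
  withBool (oddAt P 4 4) fun u => withBool (oddAt P 3 4) fun u₁ =>
  withBool (oddAt P 4 3) fun u₂ => withBool (oddAt P 4 5) fun u₃ =>
  withBool (oddAt P 5 4) fun v => withBool (oddAt P 6 4) fun v₁ =>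
  withBool (oddAt P 5 3) fun v₂ => withBool (oddAt P 5 5) fun v₃ =>
  (xor e !(secondEstimate u (!u₁ && (!u₃ && !u₂)) v (!v₁ && (!v₃ && !v₂)))) &&
    ((xor e !(u && v)) || (xor u (xor (u && u₁) (xor (u && v) (xor (u && u₂) (u && u₃)))) ||
      xor v (xor (v && u) (xor (v && v₁) (xor (v && v₂) (v && v₃))))))

/-- Whether `P` contains at least half of the edges of a cycle of length 4 or 6. -/
noncomputable def hasHalfCycle (P : List (Bool × ℕ × ℕ)) : Bool :=
  P.any fun q => (cyclesThrough q).any fun c => Nat.ble c.length (2 * c.countP (hasEdge P))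

/-- Whether `φ` is true for all the sublists of `l` of length at most `n`. -/
noncomputable def forallSublists {α : Type*} (l : List α) (n : ℕ) (φ : List α → Bool) : Bool :=
  List.rec (motive := fun _ => ℕ → (List α → Bool) → Bool) (fun _ φ => φ [])
    (fun a _ r n φ => r n φ && Nat.rec (motive := fun _ => Bool) true
      (fun m _ => r m fun P => φ (a :: P)) n) l n φ

/-- The recursion leaves out the head, or keeps it and lowers the allowed length by one; filtering
makes one of these choices at each element. -/
theorem forallSublists_spec {α : Type*} {l : List α} {n : ℕ} {φ : List α → Bool}
    (h : forallSublists l n φ = true) (f : α → Bool) (hf : (l.filter f).length ≤ n) :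
    φ (l.filter f) = true := by
  induction l generalizing n φ with
  | nil => exact h
  | cons a l ih =>
    have hcons : forallSublists (a :: l) n φ = (forallSublists l n φ &&
      Nat.rec (motive := fun _ => Bool) true
        (fun m _ => forallSublists l m fun P => φ (a :: P)) n) := rfl
    rw [hcons, Bool.and_eq_true] at h
    by_cases ha : f a = true
    · rw [List.filter_cons_of_pos ha] at hf ⊢
      cases n with
      | zero => simp at hf
      | succ n => exact ih h.2 (by simpa using hf)
    · rw [List.filter_cons_of_neg ha] at hf ⊢
      exact ih h.1 hf

/-- Whether the min-sum decoder certainly finds `P`, or `P` moved to the left. -/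
noncomputable def findsNear (s c : Dir → ℕ) (P : List (Bool × ℕ × ℕ)) : Bool :=
  Nat.beq P.length 3 && (PatchData.finds s c P ||
    PatchData.finds s c (P.map fun q => (q.1, q.2.1 - 1, q.2.2)))

/-- Up to three errors near the edge `(false, 4, 4)` are estimated correctly there, unless they make
up half of a short cycle, or they are three errors that the decoder certainly finds. -/
theorem forallSublists_nearEdges : PatchData.withSides 9 (fun s c => forallSublists nearEdges 3
    fun P => locallyDecoded P || (hasHalfCycle P || findsNear s c P)) = true := by decide +kernel

/-! ### Errors of weight at most 3 -/

theorem inPatch_nearEdges : InPatch 9 nearEdges := by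
  unfold InPatch nearEdges; decide

theorem nodup_nearEdges : nearEdges.Nodup := by decide

theorem one_le_of_mem_nearEdges : ∀ q ∈ nearEdges, 1 ≤ q.2.1 := by decide

/-- These eight vertices are the ends of the edge `(false, 4, 4)` and their other neighbours, the
only ones whose syndrome enters its first two estimates. -/
theorem edgesAt_subset_nearEdges :
    ∀ p ∈ [(4, 4), (5, 4), (3, 4), (6, 4), (4, 3), (4, 5), (5, 3), (5, 5)],
    ∀ q ∈ edgesAt p.1 p.2, q ∈ nearEdges := by decide

/-- The edges near `(false, 4, 4)` in the support of `e`. -/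
def nearSupport (L : ℕ) (b : Bool) (o : ToricVertex L) (e : ToricQubit L → ZMod 2) :
    List (Bool × ℕ × ℕ) :=
  nearEdges.filter fun q => decide (e (nqubit L b o q) ≠ 0)

section

variable {L : ℕ} (b : Bool) (o : ToricVertex L) (e : ToricQubit L → ZMod 2)

theorem inPatch_nearSupport : InPatch 9 (nearSupport L b o e) :=
  fun q hq => inPatch_nearEdges q (List.mem_of_mem_filter hq)

theorem nodup_nearSupport : (nearSupport L b o e).Nodup := nodup_nearEdges.filter _

theorem hasEdge_nearSupport {q : Bool × ℕ × ℕ} (hq : q ∈ nearEdges) :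
    hasEdge (nearSupport L b o e) q = decide (e (nqubit L b o q) ≠ 0) := by
  rw [Bool.eq_iff_iff, hasEdge_iff, nearSupport, List.mem_filter]
  simp [hq]

variable [NeZero L]

theorem oddAt_nearSupport (hL : 3 ≤ L) {x y : ℕ} (hx : 0 < x) (hy : 0 < y)
    (h : ∀ q ∈ edgesAt x y, q ∈ nearEdges) :
    oddAt (nearSupport L b o e) x y = defect (toricHZ L *ᵥ e) (npt L b o x y) := by
  simp only [edgesAt, List.mem_cons, List.not_mem_nil, or_false, forall_eq_or_imp, forall_eq] at h
  obtain ⟨x, rfl⟩ := Nat.exists_eq_succ_of_ne_zero hx.ne'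
  obtain ⟨y, rfl⟩ := Nat.exists_eq_succ_of_ne_zero hy.ne'
  simp only [Nat.succ_eq_add_one, Nat.add_sub_cancel] at h ⊢
  rw [oddAt, Nat.add_sub_cancel, Nat.add_sub_cancel, hasEdge_nearSupport b o e h.1,
    hasEdge_nearSupport b o e h.2.1, hasEdge_nearSupport b o e h.2.2.1,
    hasEdge_nearSupport b o e h.2.2.2, defect, toricHZ_mulVec hL b]
  simp only [Fintype.sum_prod_type, Fintype.sum_bool]
  rw [tedge_npt_left, tedge_npt_down, tedge_npt, tedge_npt]
  generalize e (nqubit L b o (false, x, y + 1)) = a₁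
  generalize e (nqubit L b o (false, x + 1, y + 1)) = a₂
  generalize e (nqubit L b o (true, x + 1, y)) = a₃
  generalize e (nqubit L b o (true, x + 1, y + 1)) = a₄
  revert a₁ a₂ a₃ a₄
  decide

theorem length_nearSupport_le (hL : 9 ≤ L) : (nearSupport L b o e).length ≤ hammingNorm e := by
  have h := chain_nodup hL b o (inPatch_nearSupport b o e) (nodup_nearSupport b o e)
  rw [← List.length_map (nqubit L b o), ← List.toFinset_card_of_nodup h,
    hammingNorm_eq_card_support]
  refine Finset.card_le_card fun q hq => ?_
  obtain ⟨q', hq', rfl⟩ := List.mem_map.1 (List.mem_toFinset.1 hq)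
  simpa using (List.mem_filter.1 hq').2

/-- A simulation of the nearby errors says something about `e` only if no error lies elsewhere,
which the weight ensures. -/
theorem eq_chain_nearSupport (hL : 9 ≤ L)
    (h : hammingNorm e ≤ (nearSupport L b o e).length) : e = chain L b o (nearSupport L b o e) := by
  have hnd := chain_nodup hL b o (inPatch_nearSupport b o e) (nodup_nearSupport b o e)
  have hsub : ((nearSupport L b o e).map (nqubit L b o)).toFinset ⊆
      Finset.univ.filter fun q => e q ≠ 0 := fun q hq => by
    obtain ⟨q', hq', rfl⟩ := List.mem_map.1 (List.mem_toFinset.1 hq)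
    simpa using (List.mem_filter.1 hq').2
  have heq := Finset.eq_of_subset_of_card_le hsub (by
    rw [List.toFinset_card_of_nodup hnd, List.length_map]; exact h)
  ext q
  rw [chain_apply b o hnd]
  have h1 : q ∈ (nearSupport L b o e).map (nqubit L b o) ↔ e q ≠ 0 := by
    rw [← List.mem_toFinset, heq]; simp
  simp only [h1]
  generalize e q = a
  revert a; decide

theorem isDegenerate_of_hasHalfCycle (hL : 9 ≤ L)
    (h : hasHalfCycle (nearSupport L b o e) = true) : IsDegenerate (toricHZ L) e := by
  simp only [hasHalfCycle, List.any_eq_true] at h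
  obtain ⟨q, -, c, hc, h⟩ := h
  refine (isShortCycle_of_mem hc).isDegenerate hL b o ((Nat.le_of_ble_eq_true h).trans ?_)
  refine Nat.mul_le_mul_left 2 (List.countP_mono_left fun q _ hq => ?_)
  rw [hasEdge_iff] at hq
  exact (List.mem_filter.1 hq).2

theorem msRecovers_of_findsNear (hL : 9 ≤ L)
    (tie : (ToricVertex L → ZMod 2) → ℕ → ToricQubit L → ZMod 2) (he : hammingNorm e ≤ 3)
    (h : findsNear (fun d => cellMask 9 (side 9 d)) (fun d => cellMask 9 fun x y => !side 9 d x y)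
      (nearSupport L b o e) = true) : MSRecovers (toricHZ L) tie e := by
  rw [findsNear, Bool.and_eq_true, Nat.beq_eq, Bool.or_eq_true] at h
  have h1 := eq_chain_nearSupport b o e hL (by omega)
  rw [h1]
  have hpos : ∀ q ∈ nearSupport L b o e, 1 ≤ q.2.1 := fun q hq =>
    one_le_of_mem_nearEdges q (List.mem_of_mem_filter hq)
  have hin := inPatch_nearSupport b o e
  have hnd := nodup_nearSupport b o e
  generalize nearSupport L b o e = P at *
  rcases h.2 with h | h
  · exact PatchData.msRecovers_of_finds hL hin hnd b o tie h
  -- Moving the edges to the left and the origin to the right gives the same error, placed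
  -- differently in the patch.
  · have h2 : chain L b o P =
        chain L b (npt L b o 1 0) (P.map fun q => (q.1, q.2.1 - 1, q.2.2)) := by
      rw [chain, chain, List.map_map]
      congr 1
      refine List.map_congr_left fun q hq => ?_
      rw [Function.comp_apply, nqubit_shift]
      simp only [Nat.add_sub_cancel' (hpos q hq), zero_add]
    rw [h2]
    refine PatchData.msRecovers_of_finds hL ?_ ?_ b _ tie h
    · intro q hq
      obtain ⟨q', hq', rfl⟩ := List.mem_map.1 hq
      have := hin q' hq'
      dsimp only
      omega
    · refine (List.nodup_map_iff_inj_on hnd).2 fun q hq q' hq' h => ?_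
      have := hpos q hq
      have := hpos q' hq'
      simp only [Prod.mk.injEq] at h
      exact Prod.ext h.1 (Prod.ext (by omega) h.2.2)

/-- If `locallyDecoded` holds, then the edge `(false, 4, 4)` is estimated correctly at iteration 2,
and at iteration 1 unless the syndrome is violated. -/
theorem locallyDecoded_spec (hL : 9 ≤ L)
    (h : locallyDecoded (nearSupport L b o e) = true) :
    (if decide (e (nqubit L b o (false, 4, 4)) ≠ 0) = true then
        caApp (tnb L b) (defect (toricHZ L *ᵥ e)) 2 (npt L b o 4 4) (false, true) < 0
      else 0 < caApp (tnb L b) (defect (toricHZ L *ᵥ e)) 2 (npt L b o 4 4) (false, true)) ∧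
    ((if decide (e (nqubit L b o (false, 4, 4)) ≠ 0) = true then
        caApp (tnb L b) (defect (toricHZ L *ᵥ e)) 1 (npt L b o 4 4) (false, true) < 0
      else 0 < caApp (tnb L b) (defect (toricHZ L *ᵥ e)) 1 (npt L b o 4 4) (false, true)) ∨
      Violates (tnb L b) (defect (toricHZ L *ᵥ e)) 1) := by
  have hodd := fun x y hx hy hxy => oddAt_nearSupport b o e (x := x) (y := y) (by omega) hx hy
    (edgesAt_subset_nearEdges (x, y) hxy)
  simp only [locallyDecoded, withBool_eq] at h
  rw [hasEdge_nearSupport b o e (by decide), hodd 4 4 (by decide) (by decide) (by decide),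
    hodd 5 4 (by decide) (by decide) (by decide), hodd 3 4 (by decide) (by decide) (by decide),
    hodd 6 4 (by decide) (by decide) (by decide), hodd 4 3 (by decide) (by decide) (by decide),
    hodd 4 5 (by decide) (by decide) (by decide), hodd 5 3 (by decide) (by decide) (by decide),
    hodd 5 5 (by decide) (by decide) (by decide)] at h
  set s := defect (toricHZ L *ᵥ e)
  have h1 := caApp_one (tnb L b) s (npt L b o 4 4) (false, true)
  have h2 := caApp_two (tnb L b) s (npt L b o 4 4) (false, true)
  have h3 := violates_one (tnb L b) s (npt L b o 4 4)
  have h4 := violates_one (tnb L b) s (npt L b o 5 4)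
  simp only [quiet, Bool.not_true, Bool.not_false, tnb_npt_right, tnb_npt_up,
    tnb_npt_left b o 3, tnb_npt_down b o _ 3, tnb_npt_left b o 4, Nat.reduceAdd] at h1 h2 h3 h4
  rw [Bool.and_eq_true] at h
  obtain ⟨h5, h6⟩ := h
  have h7 : ∀ a c : Bool, (xor a !c) = true → c = a := by decide
  rw [h7 _ _ h5] at h2
  refine ⟨h2, ?_⟩
  rw [Bool.or_eq_true, Bool.or_eq_true] at h6
  have h8 : ∀ a c : Bool, xor a c = true → c ≠ a := by decide
  rcases h6 with h6 | h6 | h6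
  · rw [h7 _ _ h6] at h1
    exact Or.inl h1
  · exact Or.inr (h3 (h8 _ _ h6))
  · exact Or.inr (h4 (h8 _ _ h6))

end

/-- Non-degenerate errors of weight at most 3 are corrected. -/
theorem msRecovers_of_hammingNorm_le {L : ℕ} [NeZero L] (hL : 9 ≤ L)
    (tie : (ToricVertex L → ZMod 2) → ℕ → ToricQubit L → ZMod 2) {e : ToricQubit L → ZMod 2}
    (hdeg : ¬ IsDegenerate (toricHZ L) e) (he : hammingNorm e ≤ 3) :
    MSRecovers (toricHZ L) tie e := by
  by_contra hrec
  -- Degeneracy and a successful simulation are both excluded by assumption, so only the local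
  -- alternative remains, around every edge.
  have key : ∀ (b : Bool) (o : ToricVertex L), locallyDecoded (nearSupport L b o e) = true := by
    intro b o
    have h := forallSublists_nearEdges
    rw [PatchData.withSides_eq] at h
    have h := forallSublists_spec h (fun q => decide (e (nqubit L b o q) ≠ 0))
      ((length_nearSupport_le b o e hL).trans he)
    simp only [Bool.or_eq_true] at h
    rcases h with h | h | h
    · exact h
    · exact absurd (isDegenerate_of_hasHalfCycle b o e hL h) hdeg
    · exact absurd (msRecovers_of_findsNear b o e hL tie he h) hrec
  have hest : ∀ q : ToricQubit L,
      msEstimate (toricHZ L) tie (toricHZ L *ᵥ e) 2 q = e q ∧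
      (msEstimate (toricHZ L) tie (toricHZ L *ᵥ e) 1 q = e q ∨
        toricHZ L *ᵥ msEstimate (toricHZ L) tie (toricHZ L *ᵥ e) 1 ≠ toricHZ L *ᵥ e) := by
    rintro ⟨b, v⟩
    obtain ⟨o, ho⟩ := exists_npt_eq b v 4 4
    have hspec := locallyDecoded_spec b o e hL (key b o)
    have hq : tedge L b (npt L b o 4 4) (false, true) = (b, v) := by
      rw [tedge_npt, nqubit, ho, Bool.xor_false]
    have hq' : nqubit L b o (false, 4, 4) = (b, v) := by rw [nqubit, ho, Bool.xor_false]
    have hval : (if decide (e (b, v) ≠ 0) = true then (1 : ZMod 2) else 0) = e (b, v) := by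
      generalize e (b, v) = a
      revert a; decide
    have hrw : ∀ i, (if decide (e (nqubit L b o (false, 4, 4)) ≠ 0) = true then
        caApp (tnb L b) (defect (toricHZ L *ᵥ e)) i (npt L b o 4 4) (false, true) < 0
      else 0 < caApp (tnb L b) (defect (toricHZ L *ᵥ e)) i (npt L b o 4 4) (false, true)) →
        msEstimate (toricHZ L) tie (toricHZ L *ᵥ e) i (b, v) = e (b, v) := by
      intro i hi
      have := msEstimate_tedge (by omega) b tie _ _ _ _ _ hi
      rwa [hq, hq', hval] at this
    refine ⟨hrw 2 hspec.1, hspec.2.imp (hrw 1) fun h => h.mulVec_msEstimate_ne (by omega) tie⟩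
  refine hrec (msRecovers_of_first 2 (funext fun q => (hest q).1) fun i hi h => ?_)
  interval_cases i
  -- The estimate at iteration 0 is the zero vector; if it satisfied the syndrome of `e ≠ 0`, then
  -- `e` would be degenerate.
  · by_contra hne
    have h0 : msEstimate (toricHZ L) tie (toricHZ L *ᵥ e) 0 = 0 := by
      ext q; simp [msEstimate, msApp]
    exact hdeg ⟨_, hne, by rw [h0, hammingNorm_zero]; exact Nat.zero_le _, h⟩
  · funext q
    exact (hest q).2.resolve_right (not_not.2 h)

/-! ### The distance and cuts of the torus -/

section

variable {L : ℕ}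

/-- The coordinate of a vertex along an axis. -/
def coordAlong (b : Bool) (v : ToricVertex L) : ZMod L := if b then v.2 else v.1

theorem coordAlong_add_nsmul (b : Bool) (v : ToricVertex L) (k : ℕ) :
    coordAlong b (v + k • toricStep L b) = coordAlong b v + k := by
  cases b <;> simp [coordAlong, toricStep]

theorem coordAlong_sub_nsmul (b : Bool) (v : ToricVertex L) (k : ℕ) :
    coordAlong b (v - k • toricStep L b) = coordAlong b v - k := by
  cases b <;> simp [coordAlong, toricStep]

theorem coordAlong_add_toricStep_not (b : Bool) (v : ToricVertex L) :
    coordAlong b (v + toricStep L (!b)) = coordAlong b v := by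
  cases b <;> simp [coordAlong, toricStep]

variable [NeZero L]

/-- A product of plaquettes crosses every cut of the torus an even number of times. -/
theorem sum_cut_eq_zero {e : ToricQubit L → ZMod 2}
    (he : e ∈ Submodule.span (ZMod 2) (Set.range (toricHX L).row)) (b : Bool) (x : ZMod L) :
    ∑ w with coordAlong b w = x, e (b, w) = 0 := by
  induction he using Submodule.span_induction with
  | mem e he =>
    obtain ⟨p, rfl⟩ := he
    -- The two edges in direction `b` of a plaquette differ by a step in the other direction, so
    -- they lie on the same cut and cancel.
    simp only [Matrix.row, toricHX, Matrix.of_apply, Finset.sum_add_distrib, Finset.sum_ite_eq',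
      Finset.mem_filter, Finset.mem_univ, true_and, coordAlong_add_toricStep_not]
    exact CharTwo.add_self_eq_zero _
  | zero => simp
  | add e e' _ _ h h' => simp [Finset.sum_add_distrib, h, h']
  | smul a e _ h => simp [← Finset.mul_sum, h]

theorem toricHZ_mulVec_apply (e : ToricQubit L → ZMod 2) (c : ToricVertex L) :
    (toricHZ L *ᵥ e) c = ∑ a, (e (a, c) + e (a, c - toricStep L a)) := by
  simp only [Matrix.mulVec, dotProduct, toricHZ, Matrix.of_apply, add_mul, ite_mul, one_mul,
    zero_mul, Fintype.sum_prod_type (f := fun _ : ToricQubit L => _)]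
  refine Finset.sum_congr rfl fun a _ => ?_
  simp only [Finset.sum_add_distrib, Finset.sum_ite_eq, Finset.mem_univ, if_true,
    ← sub_eq_iff_eq_add]

/-- The distance is at most `L`: it is the weight of a line that goes around the torus. -/
theorem toricDistance_le : toricDistance L ≤ L := by
  refine Nat.sInf_le ⟨fun q => if q.1 = false ∧ q.2.2 = 0 then 1 else 0, ?_,
    Or.inl ⟨?_, fun h => ?_⟩⟩
  · have : (Finset.univ.filter fun q : ToricQubit L =>
        (if q.1 = false ∧ q.2.2 = 0 then (1 : ZMod 2) else 0) ≠ 0) =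
        Finset.univ.image fun x : ZMod L => (false, x, (0 : ZMod L)) := by
      ext ⟨a, x, y⟩
      simp only [ne_eq, ite_eq_right_iff, one_ne_zero, imp_false, not_not, Finset.mem_filter,
        Finset.mem_univ, true_and, Finset.mem_image, Prod.mk.injEq]
      exact ⟨fun h => ⟨x, h.1.symm, rfl, h.2.symm⟩, fun ⟨_, h⟩ => ⟨h.1.symm, h.2.2.symm⟩⟩
    rw [hammingNorm_eq_card_support, this,
      Finset.card_image_of_injective _ fun x y h => by simpa using h, Finset.card_univ, ZMod.card]
  · ext c
    rw [toricHZ_mulVec_apply]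
    by_cases h : c.2 = 0 <;> simp [toricStep, h]
    decide
  -- The line crosses this cut in one edge only, so it is not a sum of plaquettes.
  · have := sum_cut_eq_zero h false 0
    rw [Finset.sum_eq_single (0 : ToricVertex L)] at this
    · simp at this
    · rintro ⟨x, y⟩ hx hne
      have hx : x = 0 := by simpa [coordAlong] using hx
      subst hx
      have hy : y ≠ 0 := fun h => hne (by rw [h]; rfl)
      simp [hy]
    · simp [coordAlong]

end

/-! ### Four edges in a row -/

section

variable {L : ℕ}

/-- Four consecutive horizontal edges. -/
def rowOfFour (x y : ℕ) : List (Bool × ℕ × ℕ) :=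
  [(false, x, y), (false, x + 1, y), (false, x + 2, y), (false, x + 3, y)]

theorem inPatch_rowOfFour {n x y : ℕ} (hx : x + 4 < n) (hy : y + 1 < n) :
    InPatch n (rowOfFour x y) := by
  simp only [InPatch, rowOfFour, List.mem_cons, List.not_mem_nil, or_false, forall_eq_or_imp,
    forall_eq]
  omega

theorem nodup_rowOfFour (x y : ℕ) : (rowOfFour x y).Nodup := by
  simp [rowOfFour]

theorem fourInARow_eq_chain (b : Bool) (o : ToricVertex L) {x y : ℕ} (hx : x + 4 < L)
    (hy : y + 1 < L) : fourInARow L b (npt L b o x y) = chain L b o (rowOfFour x y) := by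
  ext q
  rw [chain_apply b o (chain_nodup le_rfl b o (inPatch_rowOfFour hx hy) (nodup_rowOfFour x y)),
    fourInARow]
  have h : ∀ k : ℕ, nqubit L b o (false, x + k, y) = (b, npt L b o x y + k • toricStep L b) := by
    intro k
    simp only [nqubit, npt, Bool.xor_false, add_smul]
    congr 1
    abel
  have h0 := h 0
  rw [add_zero] at h0
  simp only [rowOfFour, List.map_cons, List.map_nil, List.mem_cons, List.not_mem_nil, or_false,
    Fin.exists_fin_succ, Fin.val_zero, h0, h, Fin.val_succ, IsEmpty.exists_iff, zero_add,
    Nat.reduceAdd]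

theorem fourInARow_ne_zero {b : Bool} {v : ToricVertex L} {q : ToricQubit L}
    (h : fourInARow L b v q ≠ 0) :
    q.1 = b ∧ ∃ k < 4, coordAlong b q.2 = coordAlong b v + (k : ℕ) := by
  simp only [fourInARow, ne_eq, ite_eq_right_iff, one_ne_zero, imp_false, not_not] at h
  obtain ⟨k, rfl⟩ := h
  exact ⟨rfl, k, k.2, coordAlong_add_nsmul b v k⟩

variable [NeZero L]

theorem hammingNorm_fourInARow (hL : 9 ≤ L) (b : Bool) (v : ToricVertex L) :
    hammingNorm (fourInARow L b v) = 4 := by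
  obtain ⟨o, rfl⟩ := exists_npt_eq b v 0 0
  have hnd := chain_nodup (L := L) le_rfl b o (inPatch_rowOfFour (x := 0) (y := 0)
    (by omega) (by omega)) (nodup_rowOfFour 0 0)
  rw [fourInARow_eq_chain b o (by omega) (by omega), hammingNorm_eq_card_support]
  have : (Finset.univ.filter fun q => chain L b o (rowOfFour 0 0) q ≠ 0) =
      ((rowOfFour 0 0).map (nqubit L b o)).toFinset := by
    ext q
    simp [chain_apply b o hnd, -List.mem_map]
  rw [this, List.toFinset_card_of_nodup hnd]
  rfl

theorem sum_cut_fourInARow (hL : 9 ≤ L) (b : Bool) (v : ToricVertex L) {k : ℕ} (hk : k < 4) :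
    ∑ w with coordAlong b w = coordAlong b v + (k : ZMod L), fourInARow L b v (b, w) = 1 := by
  rw [Finset.sum_eq_single (v + k • toricStep L b)]
  · rw [fourInARow, if_pos ⟨⟨k, hk⟩, rfl⟩]
  · intro w hw hne
    rw [fourInARow, if_neg]
    rintro ⟨k', h⟩
    simp only [Prod.mk.injEq, true_and] at h
    rw [Finset.mem_filter, h, coordAlong_add_nsmul, add_right_inj,
      ZMod.natCast_eq_natCast_iff', Nat.mod_eq_of_lt (by omega), Nat.mod_eq_of_lt (by omega)] at hw
    exact hne (by rw [h, hw.2])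
  · intro h
    exact absurd (by simpa only [Finset.mem_filter, Finset.mem_univ, true_and] using
      coordAlong_add_nsmul b v k) h

theorem not_isDegenerate_fourInARow (hL : 9 ≤ toricDistance L) (b : Bool) (v : ToricVertex L) :
    ¬ IsDegenerate (toricHZ L) (fourInARow L b v) := by
  have hL' : 9 ≤ L := hL.trans toricDistance_le
  rintro ⟨e, hne, hw, hs⟩
  rw [hammingNorm_fourInARow hL'] at hw
  have hker : toricHZ L *ᵥ (e - fourInARow L b v) = 0 := by rw [Matrix.mulVec_sub, hs, sub_self]
  have hnorm : hammingNorm (e - fourInARow L b v) ≤ 8 := by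
    have h1 := hammingDist_triangle (fourInARow L b v) 0 e
    rw [hammingDist_eq_hammingNorm, neg_add_eq_sub, hammingDist_zero_right, hammingDist_zero_left,
      hammingNorm_fourInARow hL'] at h1
    omega
  -- A cycle of weight at most 8 is below the distance, so it is not a logical operator. This makes
  -- the cut argument available.
  have hspan : e - fourInARow L b v ∈ Submodule.span (ZMod 2) (Set.range (toricHX L).row) := by
    by_contra h
    have : toricDistance L ≤ _ := Nat.sInf_le ⟨_, rfl, Or.inl ⟨hker, h⟩⟩
    omega
  -- The row crosses each of its four cuts once and the difference crosses it evenly, so `e` crosses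
  -- it at least once.
  have hq : ∀ k : Fin 4, ∃ w, coordAlong b w = coordAlong b v + ((k : ℕ) : ZMod L) ∧
      e (b, w) ≠ 0 := by
    intro k
    have h1 := sum_cut_eq_zero hspan b (coordAlong b v + ((k : ℕ) : ZMod L))
    simp only [Pi.sub_apply, Finset.sum_sub_distrib, sum_cut_fourInARow hL' b v k.2] at h1
    obtain ⟨w, hw, h2⟩ := Finset.exists_ne_zero_of_sum_ne_zero
      (by rw [sub_eq_zero.1 h1]; exact one_ne_zero)
    exact ⟨w, (Finset.mem_filter.1 hw).2, h2⟩
  choose w hw1 hw2 using hq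
  have hinj : Function.Injective fun k => ((b, w k) : ToricQubit L) := by
    intro k k' h
    simp only [Prod.mk.injEq, true_and] at h
    have h1 := hw1 k
    rw [h, hw1 k', add_right_inj, ZMod.natCast_eq_natCast_iff', Nat.mod_eq_of_lt (by omega),
      Nat.mod_eq_of_lt (by omega)] at h1
    exact Fin.ext h1.symm
  -- Four edges on distinct cuts exhaust the weight of `e`, which therefore has no edge in the other
  -- direction or on another cut.
  have himage : Finset.univ.image (fun k => ((b, w k) : ToricQubit L)) =
      Finset.univ.filter fun q => e q ≠ 0 := by
    refine Finset.eq_of_subset_of_card_le (fun q hq => ?_) ?_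
    · obtain ⟨k, -, rfl⟩ := Finset.mem_image.1 hq
      simpa using hw2 k
    · rw [Finset.card_image_of_injective _ hinj]
      simpa [hammingNorm_eq_card_support] using hw
  have hsupp : ∀ q, (e - fourInARow L b v) q ≠ 0 →
      q.1 = b ∧ ∃ k < 4, coordAlong b q.2 = coordAlong b v + (k : ℕ) := by
    intro q hq
    by_cases h : e q = 0
    · exact fourInARow_ne_zero (by simpa [h] using hq)
    · have : q ∈ Finset.univ.image fun k => ((b, w k) : ToricQubit L) := by
        rw [himage]; simpa using h
      obtain ⟨k, -, rfl⟩ := Finset.mem_image.1 this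
      exact ⟨rfl, k, k.2, hw1 k⟩
  suffices h : e - fourInARow L b v = 0 from hne (sub_eq_zero.1 h)
  generalize e - fourInARow L b v = d at hker hsupp
  have hother : ∀ u, d (!b, u) = 0 := by
    intro u
    by_contra h
    have := (hsupp _ h).1
    simp at this
  -- A cycle without edges in the other direction takes equal values on the two remaining edges at
  -- each vertex, so it is constant along lines.
  have hstep : ∀ u, d (b, u - toricStep L b) =
      d (b, u) := by
    intro u
    have h1 := congrFun hker u
    rw [toricHZ_mulVec_apply, Fintype.sum_bool] at h1
    have h2 : d (b, u) + d (b, u - toricStep L b) = 0 := by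
      cases b
      · simpa [show ∀ u, d (true, u) = 0 from hother] using h1
      · simpa [show ∀ u, d (false, u) = 0 from hother] using h1
    exact (CharTwo.add_eq_zero.1 h2).symm
  have hsteps : ∀ (k : ℕ) u, d (b, u - k • toricStep L b) =
      d (b, u) := by
    intro k
    induction k with
    | zero => simp
    | succ k ih => intro u; rw [succ_nsmul, ← sub_sub, hstep, ih]
  funext q
  by_contra hq0
  obtain ⟨q₁, u⟩ := q
  obtain rfl : q₁ = b := (hsupp _ hq0).1
  -- This many steps back lead to the cut just before the row, where `d` vanishes: `-1` would have
  -- to be one of `0, …, 3` modulo `L`.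
  rw [← hsteps (coordAlong q₁ u - coordAlong q₁ v + 1).val u] at hq0
  obtain ⟨k, hk, h⟩ := (hsupp _ hq0).2
  rw [coordAlong_sub_nsmul, ZMod.natCast_val, ZMod.cast_id] at h
  refine natCast_ne_zero_of_lt (L := L) (k := k + 1) (by omega) (by omega) ?_
  push_cast
  linear_combination -h

/-- The bounds after 9 iterations recur with period 6, and all the iterations involved violate the
syndrome. The patch is the whole torus. -/
theorem neverStops_nine : PatchData.neverStops 9 true (rowOfFour 2 4) 9 6 = true := by
  decide +kernel

theorem neverStops_ten : PatchData.neverStops 10 true (rowOfFour 2 4) 9 6 = true := by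
  decide +kernel

/-- On an open patch only a positive lower bound is known for the incoming messages, so the result
does not depend on the size of the torus. -/
theorem neverStops_eleven : PatchData.neverStops 11 false (rowOfFour 3 5) 9 6 = true := by
  decide +kernel

theorem mulVec_msEstimate_fourInARow_ne (hL : 9 ≤ L)
    (tie : (ToricVertex L → ZMod 2) → ℕ → ToricQubit L → ZMod 2) (b : Bool) (v : ToricVertex L)
    (i : ℕ) : toricHZ L *ᵥ msEstimate (toricHZ L) tie (toricHZ L *ᵥ fourInARow L b v) i ≠
      toricHZ L *ᵥ fourInARow L b v := by
  rcases le_or_gt 11 L with h | h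
  · obtain ⟨o, rfl⟩ := exists_npt_eq b v 3 5
    rw [fourInARow_eq_chain b o (by omega) (by omega)]
    exact PatchData.mulVec_msEstimate_ne_of_neverStops neverStops_eleven (by omega) (by omega) h
      (by simp) (inPatch_rowOfFour (by omega) (by omega)) (by omega) b o tie i
  · obtain ⟨o, rfl⟩ := exists_npt_eq b v 2 4
    rw [fourInARow_eq_chain b o (by omega) (by omega)]
    obtain rfl | rfl : L = 9 ∨ L = 10 := by omega
    · exact PatchData.mulVec_msEstimate_ne_of_neverStops neverStops_nine (by omega) (by omega)
        le_rfl (fun _ => rfl) (inPatch_rowOfFour (by omega) (by omega)) (by omega) b o tie i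
    · exact PatchData.mulVec_msEstimate_ne_of_neverStops neverStops_ten (by omega) (by omega)
        le_rfl (fun _ => rfl) (inPatch_rowOfFour (by omega) (by omega)) (by omega) b o tie i

end

/-! ### The decoding radius -/

theorem isNonDegenerateDecodingRadius_of_witness {C Q : Type*} [Fintype C] [DecidableEq C]
    [Fintype Q] [DecidableEq Q] {H : Matrix C Q (ZMod 2)} {Decoded : (Q → ZMod 2) → Prop} {ω : ℕ}
    (h : ∀ e, ¬ IsDegenerate H e → hammingNorm e ≤ ω → Decoded e) {ε : Q → ZMod 2}
    (hε : hammingNorm ε = ω + 1) (hdeg : ¬ IsDegenerate H ε) (hdec : ¬ Decoded ε) :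
    IsNonDegenerateDecodingRadius H Decoded ω := by
  refine ⟨h, fun w hw => ?_⟩
  by_contra hlt
  exact hdec (hw ε hdeg (by omega))

theorem MSRecovers.msFindsCorrection {C Q : Type*} [Fintype C] [DecidableEq C] [Fintype Q]
    [DecidableEq Q] {H : Matrix C Q (ZMod 2)} {tie : (C → ZMod 2) → ℕ → Q → ZMod 2}
    {e : Q → ZMod 2} (h : MSRecovers H tie e) : MSFindsCorrection H tie e :=
  let ⟨k, hk, _⟩ := h
  ⟨k, hk⟩

theorem theorem2 (L : ℕ) [NeZero L] (hL : 9 ≤ toricDistance L)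
    (tie : (ToricVertex L → ZMod 2) → ℕ → ToricQubit L → ZMod 2) :
    IsNonDegenerateDecodingRadius (toricHZ L) (MSRecovers (toricHZ L) tie) 3 ∧
    IsNonDegenerateDecodingRadius (toricHZ L) (MSFindsCorrection (toricHZ L) tie) 3 ∧
    ∀ (b : Bool) (v : ToricVertex L),
      hammingNorm (fourInARow L b v) = 4 ∧
      ¬ IsDegenerate (toricHZ L) (fourInARow L b v) ∧
      ¬ MSFindsCorrection (toricHZ L) tie (fourInARow L b v) := by
  have hL' : 9 ≤ L := hL.trans toricDistance_le
  have hfour : ∀ (b : Bool) (v : ToricVertex L),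
      ¬ MSFindsCorrection (toricHZ L) tie (fourInARow L b v) := by
    rintro b v ⟨k, hk⟩
    exact mulVec_msEstimate_fourInARow_ne hL' tie b v k hk.1
  refine ⟨?_, ?_, fun b v => ⟨hammingNorm_fourInARow hL' b v, not_isDegenerate_fourInARow hL b v,
    hfour b v⟩⟩
  · exact isNonDegenerateDecodingRadius_of_witness
      (fun e hdeg he => msRecovers_of_hammingNorm_le hL' tie hdeg he)
      (hammingNorm_fourInARow hL' false 0) (not_isDegenerate_fourInARow hL false 0)
      fun h => hfour false 0 h.msFindsCorrection
  · exact isNonDegenerateDecodingRadius_of_witness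
      (fun e hdeg he => (msRecovers_of_hammingNorm_le hL' tie hdeg he).msFindsCorrection)
      (hammingNorm_fourInARow hL' false 0) (not_isDegenerate_fourInARow hL false 0)
      (hfour false 0)
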